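/- **Setting.** Let $d\ge 1$. Let $\mathcal S_d$ be the set of $\phi:\mathbb Z^d\to\mathbb C$ with $\sum_{x\in\mathbb Z^d}|x^\beta\phi(x)|<\infty$ for every multi-index $\beta\in\mathbb N^d$. Put $\widehat\phi(\xi)=\sum_{x\in\mathbb Z^d}\phi(x)e^{ix\cdot\xi}$ for $\xi\in\mathbb R^d$. The convolution powers are $\phi^{(1)}=\phi$ and $\phi^{(n+1)}=\phi^{(n)}*\phi$, where $(\psi*\phi)(x)=\sum_{y\in\mathbb Z^d}\psi(x-y)\phi(y)$. If $\sup_\xi|\widehat\phi(\xi)|=1$, let $\Omega(\phi)=\{\xi\in(-\pi,\pi]^d:|\widehat\phi(\xi)|=1\}$. **Homogeneity.** For an endomorphism $E$ of $\mathbb R^d$ and $r>0$ let $r^E=\exp((\ln r)E)$; $\{r^E\}$ is contracting if $\|r^E\|\to0$ as $r\to0^+$. A function $P:\mathbb R^d\to\mathbb R$ is homogeneous with respect to $E$ if $rP(x)=P(r^Ex)$ for all $r>0$ and $x\in\mathbb R^d$; the set of such $E$ is denoted $\operatorname{Exp}(P)$. $P$ is positive homogeneous if it is continuous, $P\ge0$,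 $P(x)=0$ only for $x=0$, $\operatorname{Exp}(P)\ne\varnothing$, and $\{r^E\}$ is contracting for each $E\in\operatorname{Exp}(P)$; then $\operatorname{tr}E$ is the same for all $E\in\operatorname{Exp}(P)$ and is denoted $\mu_P$. Let $\{r^E\}$ be contracting and let $f$ be a function on an open neighbourhood $\mathcal U$ of $0$. If $f$ is continuous, it is subhomogeneous with respect to $E$ if for every $\epsilon>0$ and compact $K\subseteq\mathbb R^d$ there is $\delta>0$ with $|f(r^E\xi)|\le\epsilon r$ for all $0<r<\delta$, $\xi\in K$. If $f\in C^l(\mathcal U)$, it is strongly subhomogeneous with respect to $E$ of order $l\ge1$ if for every $\epsilon>0$ and compact $K$ there is $\delta>0$ with $|r^j\partial_r^j f(r^E\xi)|\le\epsilon r$ for all $1\le j\le l$, $0<r<\delta$, $\xi\in K$. **Types.** Let $\phi\in\mathcal S_d$ with $\sup|\widehat\phi|=1$ and let $\xi_0\in\Omega(\phi)$. On small convex open neighbourhoods $\mathcal U$ of $0$ put $\Gamma_{\xi_0}(\xi)=\log\big(\widehat\phi(\xi+\xi_0)/\widehat\phi(\xi_0)\big)$ (principal branch). The drift $\alpha_{\xi_0}\in\mathbb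 R^d$ is the vector for which $i\alpha_{\xi_0}\cdot\xi$ is the linear term of the Taylor expansion of $\Gamma_{\xi_0}$ at $0$. Consider expansions $$\Gamma_{\xi_0}(\xi)=i\alpha_{\xi_0}\cdot\xi-i\big(Q(\xi)+\widetilde Q(\xi)\big)-\big(R(\xi)+\widetilde R(\xi)\big),\qquad \xi\in\mathcal U,$$ where $Q,R$ are real polynomials without constant and linear terms and $\widetilde Q,\widetilde R$ are real-valued, smooth on $\mathcal U$ and vanish at $0$. * $\xi_0$ is of *positive homogeneous type* if there is such an expansion in which $R$ is positive homogeneous and, for some $E\in\operatorname{Exp}(R)$, $Q$ is homogeneous with respect to $E$ and $\widetilde R,\widetilde Q$ are subhomogeneous with respect to $E$. Its homogeneous order is $\mu_{\xi_0}=\mu_R$. * $\xi_0$ is of *imaginary homogeneous type* if there is such an expansion in which $|Q|$ and $R$ are positive homogeneous and, for some $E\in\operatorname{Exp}(|Q|)$ and $k>1$, $R$ is homogeneous with respect to $E/k$, $\widetilde Q$ is strongly subhomogeneous with respect to $E$ of order $2$, and $\widetilde R$ is strongly subhomogeneous with respect to $E/k$ of order $1$. Its homogeneous order is $\mu_{\xi_0}=\mu_{|Q|}$.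 **Theorem.** Let $\phi\in\mathcal S_d$ be such that $\sup|\widehat\phi|=1$, and suppose that each $\xi_0\in\Omega(\phi)$ is of positive homogeneous or imaginary homogeneous type. Suppose further that $\alpha_{\xi_0}=0$ and $\mu_{\xi_0}<1$ for each $\xi_0\in\Omega(\phi)$ of imaginary homogeneous type. Then $\Omega(\phi)$ is finite, $\mu_\phi=\min_{\xi\in\Omega(\phi)}\mu_\xi$ exists, and for each compact set $K\subseteq\mathbb R^d$ there is a constant $C_K>0$ for which $$|\phi^{(n)}(x)|\le\frac{C_K}{n^{\mu_\phi}}\qquad\text{for all }x\in K\cap\mathbb Z^d\text{ and all integers }n\ge1.$$ -/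

import Mathlib

open scoped Topology ContDiff

namespace ConvPower

/-- Euclidean space `ℝ^d`. -/
abbrev E (d : ℕ) : Type := EuclideanSpace ℝ (Fin d)

/-- Endomorphisms of `ℝ^d`, with the operator norm. -/
abbrev End (d : ℕ) : Type := E d →L[ℝ] E d

/-! ### One-parameter groups and homogeneity -/

/-- `r ^ A = exp ((log r) A)` for `r > 0` and an endomorphism `A` of `ℝ^d`. -/
noncomputable def opPow {d : ℕ} (r : ℝ) (A : End d) : End d :=
  NormedSpace.exp (Real.log r • A)

/-- The group `r ↦ r ^ A` is contracting: `‖r ^ A‖ → 0` as `r → 0⁺`. -/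
def IsContracting {d : ℕ} (A : End d) : Prop :=
  Filter.Tendsto (fun r : ℝ => ‖opPow r A‖) (𝓝[>] 0) (𝓝 0)

/-- The trace of an endomorphism. -/
noncomputable def tr {d : ℕ} (A : End d) : ℝ :=
  LinearMap.trace ℝ (E d) (A : E d →ₗ[ℝ] E d)

/-- `P` is homogeneous with respect to `A`: `r P(x) = P(r ^ A x)` for all `r > 0` and `x`. -/
def IsHomogeneousWrt {d : ℕ} (P : E d → ℝ) (A : End d) : Prop :=
  ∀ r : ℝ, 0 < r → ∀ x : E d, r * P x = P (opPow r A x)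

/-- The exponent set `Exp(P)`. -/
def expSet {d : ℕ} (P : E d → ℝ) : Set (End d) :=
  {A | IsHomogeneousWrt P A}

/-- `P` is non-negative and vanishes only at `0`. -/
def IsPosDef {d : ℕ} (P : E d → ℝ) : Prop :=
  (∀ x, 0 ≤ P x) ∧ ∀ x, P x = 0 → x = 0

/-- Positive homogeneous functions: continuous, positive definite, `Exp(P)` is non-empty, and
`r ^ A` is contracting for each `A ∈ Exp(P)`. (For continuous positive definite `P` with
`Exp(P) ≠ ∅` the last condition is equivalent to compactness of `{P = 1}`, to `P(x) → ∞` as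
`x → ∞`, and to `r ^ A` being contracting for some `A ∈ Exp(P)`.) -/
structure IsPositiveHomogeneous {d : ℕ} (P : E d → ℝ) : Prop where
  continuous : Continuous P
  posDef : IsPosDef P
  nonempty : (expSet P).Nonempty
  contracting : ∀ A ∈ expSet P, IsContracting A

/-- `f`, continuous on a neighbourhood `O` of `0`, is subhomogeneous with respect to `A`.
The values of `f` outside `O` play no role when `r ^ A` is contracting. -/
def IsSubhomogeneous {d : ℕ} (O : Set (E d)) (f : E d → ℝ) (A : End d) : Prop :=
  ContinuousOn f O ∧
    ∀ ε : ℝ, 0 < ε → ∀ K : Set (E d), IsCompact K →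
      ∃ δ : ℝ, 0 < δ ∧ ∀ r : ℝ, 0 < r → r < δ → ∀ x ∈ K, |f (opPow r A x)| ≤ ε * r

/-- `f ∈ C^l(O)` is strongly subhomogeneous with respect to `A` of order `l`. -/
def IsStronglySubhomogeneous {d : ℕ} (l : ℕ) (O : Set (E d)) (f : E d → ℝ) (A : End d) : Prop :=
  ContDiffOn ℝ l f O ∧
    ∀ ε : ℝ, 0 < ε → ∀ K : Set (E d), IsCompact K →
      ∃ δ : ℝ, 0 < δ ∧ ∀ j : ℕ, 1 ≤ j → j ≤ l → ∀ r : ℝ, 0 < r → r < δ → ∀ x ∈ K,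
        |r ^ j * iteratedDeriv j (fun s : ℝ => f (opPow s A x)) r| ≤ ε * r

/-! ### Convolution powers and the Fourier transform on `ℤ^d` -/

/-- The point of `ℝ^d` given by a lattice point. -/
noncomputable def latticePt {d : ℕ} (x : Fin d → ℤ) : E d :=
  WithLp.toLp 2 (fun i => (x i : ℝ))

/-- The class `𝓢_d`: all moments `∑ₓ |x^β φ(x)|` are finite. -/
def MemS {d : ℕ} (φ : (Fin d → ℤ) → ℂ) : Prop :=
  ∀ β : Fin d → ℕ, Summable (fun x : Fin d → ℤ => ‖(∏ i, (x i : ℂ) ^ β i) * φ x‖)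

/-- Convolution on `ℤ^d`. -/
noncomputable def conv {d : ℕ} (ψ φ : (Fin d → ℤ) → ℂ) : (Fin d → ℤ) → ℂ :=
  fun x => ∑' y : Fin d → ℤ, ψ (x - y) * φ y

/-- The `n`-fold convolution power: `φ⁽⁰⁾ = δ₀`, `φ⁽ⁿ⁺¹⁾ = φ⁽ⁿ⁾ * φ`; so `φ⁽¹⁾ = φ`. -/
noncomputable def convPow {d : ℕ} (φ : (Fin d → ℤ) → ℂ) : ℕ → (Fin d → ℤ) → ℂ
  | 0 => Pi.single 0 1
  | n + 1 => conv (convPow φ n) φ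

/-- The Fourier transform `∑ₓ φ(x) e^{i x·ξ}`. -/
noncomputable def fourier {d : ℕ} (φ : (Fin d → ℤ) → ℂ) (ξ : E d) : ℂ :=
  ∑' x : Fin d → ℤ, φ x * Complex.exp (Complex.I * ((inner ℝ (latticePt x) ξ : ℝ) : ℂ))

/-- `Ω(φ)`: the points of `(-π, π]^d` at which the Fourier transform has modulus `1`. -/
def maxSet {d : ℕ} (φ : (Fin d → ℤ) → ℂ) : Set (E d) :=
  {ξ | (∀ i, ξ i ∈ Set.Ioc (-Real.pi) Real.pi) ∧ ‖fourier φ ξ‖ = 1}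

/-! ### Local expansions at points of `Ω(φ)` -/

/-- `Γ_{ξ₀}(ξ) = log (φ̂(ξ + ξ₀) / φ̂(ξ₀))`, principal branch. -/
noncomputable def logRatio {d : ℕ} (φ : (Fin d → ℤ) → ℂ) (ξ₀ ξ : E d) : ℂ :=
  Complex.log (fourier φ (ξ + ξ₀) / fourier φ ξ₀)

/-- The drift `α_{ξ₀}`: the vector for which `i α·ξ` is the linear Taylor term of `Γ_{ξ₀}` at `0`
(whose real part vanishes as `|φ̂|` is maximal at `ξ₀`). -/
noncomputable def drift {d : ℕ} (φ : (Fin d → ℤ) → ℂ) (ξ₀ : E d) : E d :=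
  gradient (fun ξ => (logRatio φ ξ₀ ξ).im) 0

/-- The function on `ℝ^d` defined by a real polynomial in `d` variables. -/
noncomputable def polyFun {d : ℕ} (p : MvPolynomial (Fin d) ℝ) : E d → ℝ :=
  fun ξ => MvPolynomial.eval (fun i => ξ i) p

/-- `p` vanishes at `0` and has no linear terms. -/
def NoLowTerms {d : ℕ} (p : MvPolynomial (Fin d) ℝ) : Prop :=
  MvPolynomial.coeff 0 p = 0 ∧ ∀ i : Fin d, MvPolynomial.coeff (Finsupp.single i 1) p = 0

/-- The expansion `Γ_{ξ₀}(ξ) = i α·ξ - i (Q(ξ) + Q'(ξ)) - (R(ξ) + R'(ξ))` on a convex open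
neighbourhood `U` of `0` on which the principal logarithm is continuous, where `α` is the drift,
`Q`, `R` are real polynomials without constant and linear terms, and the remainders `Q'`, `R'`
are real-valued, smooth on `U` and vanish at `0`. -/
structure IsExpansion {d : ℕ} (φ : (Fin d → ℤ) → ℂ) (ξ₀ : E d) (U : Set (E d))
    (Q R : MvPolynomial (Fin d) ℝ) (Q' R' : E d → ℝ) : Prop where
  isOpen : IsOpen U
  convex : Convex ℝ U
  zero_mem : (0 : E d) ∈ U
  mem_slitPlane : ∀ ξ ∈ U, fourier φ (ξ + ξ₀) / fourier φ ξ₀ ∈ Complex.slitPlane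
  noLowTerms_Q : NoLowTerms Q
  noLowTerms_R : NoLowTerms R
  smooth_Q' : ContDiffOn ℝ ∞ Q' U
  smooth_R' : ContDiffOn ℝ ∞ R' U
  Q'_zero : Q' 0 = 0
  R'_zero : R' 0 = 0
  eq : ∀ ξ ∈ U, logRatio φ ξ₀ ξ =
    Complex.I * ((inner ℝ (drift φ ξ₀) ξ : ℝ) : ℂ)
      - Complex.I * ((polyFun Q ξ + Q' ξ : ℝ) : ℂ) - ((polyFun R ξ + R' ξ : ℝ) : ℂ)

/-- `ξ₀` is of positive homogeneous type for `φ̂`, with homogeneous order `μ = μ_R = tr A`. -/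
def HasPositiveHomogeneousType {d : ℕ} (φ : (Fin d → ℤ) → ℂ) (ξ₀ : E d) (μ : ℝ) : Prop :=
  ∃ (U : Set (E d)) (Q R : MvPolynomial (Fin d) ℝ) (Q' R' : E d → ℝ),
    IsExpansion φ ξ₀ U Q R Q' R' ∧
    IsPositiveHomogeneous (polyFun R) ∧
    ∃ A ∈ expSet (polyFun R),
      IsHomogeneousWrt (polyFun Q) A ∧
      IsSubhomogeneous U R' A ∧
      IsSubhomogeneous U Q' A ∧
      μ = tr A

/-- `ξ₀` is of imaginary homogeneous type for `φ̂`, with homogeneous order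
`μ = μ_{|Q|} = tr A`. -/
def HasImaginaryHomogeneousType {d : ℕ} (φ : (Fin d → ℤ) → ℂ) (ξ₀ : E d) (μ : ℝ) : Prop :=
  ∃ (U : Set (E d)) (Q R : MvPolynomial (Fin d) ℝ) (Q' R' : E d → ℝ),
    IsExpansion φ ξ₀ U Q R Q' R' ∧
    IsPositiveHomogeneous (fun ξ => |polyFun Q ξ|) ∧
    IsPositiveHomogeneous (polyFun R) ∧
    ∃ A ∈ expSet (fun ξ => |polyFun Q ξ|), ∃ k : ℝ, 1 < k ∧
      IsHomogeneousWrt (polyFun R) (k⁻¹ • A) ∧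
      IsStronglySubhomogeneous 2 U Q' A ∧
      IsStronglySubhomogeneous 1 U R' (k⁻¹ • A) ∧
      μ = tr A

/-- `ξ₀` is of positive homogeneous type for `φ̂`. -/
def IsPositiveHomogeneousType {d : ℕ} (φ : (Fin d → ℤ) → ℂ) (ξ₀ : E d) : Prop :=
  ∃ μ, HasPositiveHomogeneousType φ ξ₀ μ

/-- `ξ₀` is of imaginary homogeneous type for `φ̂`. -/
def IsImaginaryHomogeneousType {d : ℕ} (φ : (Fin d → ℤ) → ℂ) (ξ₀ : E d) : Prop :=
  ∃ μ, HasImaginaryHomogeneousType φ ξ₀ μ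

open Classical in
/-- The homogeneous order `μ_{ξ₀}` of a point of positive or imaginary homogeneous type. The
number is the same for all admissible expansions and exponents: `tr A` is the rate in
`vol {|P| < t} = c t ^ (tr A)`, where `P` is the leading part `R`, resp. `Q`, and the leading
parts of two admissible expansions are asymptotic to each other at `0`.
(It is set to `0` at points of neither type.) -/
noncomputable def homogeneousOrder {d : ℕ} (φ : (Fin d → ℤ) → ℂ) (ξ₀ : E d) : ℝ :=
  if h : ∃ μ, HasPositiveHomogeneousType φ ξ₀ μ ∨ HasImaginaryHomogeneousType φ ξ₀ μ then
    h.choose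
  else 0

/-- `μ_φ`, the minimum of the homogeneous orders of the points of `Ω(φ)`. -/
noncomputable def minOrder {d : ℕ} (φ : (Fin d → ℤ) → ℂ) : ℝ :=
  sInf (homogeneousOrder φ '' maxSet φ)

end ConvPower

namespace ConvPower

/-! By Fourier inversion (`setIntegral_cube_inversionKernel`), `convPow φ n x` is, up to the factor
(2π)^d, the integral of φ̂(ξ)^n e^{-ix·ξ} over a cube of side 2π. Away from the points where |φ̂| =
1 the integrand decays geometrically in n, so only small neighbourhoods of these points matter. Each
type forces |φ̂| < 1 near such a point except at the point itself, so by compactness there are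
finitely many of them modulo 2πℤ^d.

At a point of positive homogeneous type, |φ̂|^n ≤ exp(-nR/2) nearby, and rescaling by n^{-A} gives
n^{-tr A}. Oscillation plays no role.

At a point of imaginary homogeneous type the modulus alone gives too little, and the decay comes
from the phase nQ. The region |Q| < 1/n has volume of order n^{-μ}, where μ = tr A. On the rest one
integrates along the orbits t ↦ t^A y in generalized polar coordinates
(`IsPositiveHomogeneous.setIntegral_annulus_eq`). There the phase is n(±|Q(y)|t + lower order), with
derivative of size at least n/2, and the Jacobian weight is t^{μ-1}. One integration by parts
(`norm_integral_exp_I_mul_le`) bounds the orbit integral by a constant times (1/n)a^{μ-1} with a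
comparable to 1/n, hence by n^{-μ}. The condition μ < 1 makes the weight decreasing, so that the
lower endpoint dominates. Vanishing drift keeps a linear term, growing with n, out of the phase. The
damping exp(-nR) is harmless because y e^{-cy} is bounded (`exists_hasDerivAt_amplitude`). The
factor e^{-ix·ξ} joins the amplitude, so the constants depend on x; a compact set contains only
finitely many lattice points. -/

open MeasureTheory Set Filter

/-! ### Exponentials of endomorphisms and their determinants. -/

section OperatorExponential

variable {V : Type*} [NormedAddCommGroup V] [NormedSpace ℝ V]

theorem exp_zero_smul (A : V →L[ℝ] V) : NormedSpace.exp ((0 : ℝ) • A) = 1 := by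
  rw [zero_smul, NormedSpace.exp_zero]

variable [FiniteDimensional ℝ V]

theorem exp_add_smul (A : V →L[ℝ] V) (s t : ℝ) :
    NormedSpace.exp ((s + t) • A) = NormedSpace.exp (s • A) * NormedSpace.exp (t • A) := by
  let : NormedAlgebra ℚ (V →L[ℝ] V) := NormedAlgebra.restrictScalars ℚ ℝ (V →L[ℝ] V)
  have : CompleteSpace V := FiniteDimensional.complete ℝ V
  rw [add_smul, NormedSpace.exp_add_of_commute]
  exact ((Commute.refl A).smul_left _).smul_right _

theorem continuous_exp_smul_apply (A : V →L[ℝ] V) :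
    Continuous fun p : ℝ × V => NormedSpace.exp (p.1 • A) p.2 := by
  let : NormedAlgebra ℚ (V →L[ℝ] V) := NormedAlgebra.restrictScalars ℚ ℝ (V →L[ℝ] V)
  have : CompleteSpace V := FiniteDimensional.complete ℝ V
  exact (NormedSpace.exp_continuous.comp (continuous_fst.smul continuous_const)).clm_apply
    continuous_snd

theorem hasDerivAt_exp_smul_apply (A : V →L[ℝ] V) (s : ℝ) (x : V) :
    HasDerivAt (fun s : ℝ => NormedSpace.exp (s • A) x) (A (NormedSpace.exp (s • A) x)) s := by
  have : CompleteSpace V := FiniteDimensional.complete ℝ V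
  simpa using (hasDerivAt_exp_smul_const' (𝕂 := ℝ) A s).clm_apply (hasDerivAt_const s x)

theorem contDiff_exp_smul_apply (A : V →L[ℝ] V) (x : V) (n : ℕ∞) :
    ContDiff ℝ n (fun s : ℝ => NormedSpace.exp (s • A) x) := by
  have : CompleteSpace V := FiniteDimensional.complete ℝ V
  have h1 : ContDiff ℝ n (fun B : V →L[ℝ] V => NormedSpace.exp B) := by
    have : AnalyticOnNhd ℝ (fun B : V →L[ℝ] V => NormedSpace.exp B) univ :=
      fun B _ => NormedSpace.exp_analytic B
    exact this.contDiff
  exact (h1.comp (contDiff_id.smul contDiff_const)).clm_apply contDiff_const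

theorem differentiable_det_matrix (n : ℕ) :
    Differentiable ℝ (fun M : Fin n → Fin n → ℝ => Matrix.det (Matrix.of M)) := by
  simp only [Matrix.det_apply, Matrix.of_apply]
  fun_prop

/-- The curves exp(hA) and 1 + hA agree to first order at h = 0, so the chain rule gives their
determinants the same derivative. For the second curve the determinant is a polynomial in h whose
linear coefficient is the trace. -/
theorem hasDerivAt_det_exp_smul (A : V →L[ℝ] V) :
    HasDerivAt (fun h : ℝ => LinearMap.det ((NormedSpace.exp (h • A) : V →L[ℝ] V) : V →ₗ[ℝ] V))
      (LinearMap.trace ℝ V (A : V →ₗ[ℝ] V)) 0 := by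
  have : CompleteSpace V := FiniteDimensional.complete ℝ V
  set b := Module.finBasis ℝ V
  let L : (V →L[ℝ] V) →L[ℝ] (Fin (Module.finrank ℝ V) → Fin (Module.finrank ℝ V) → ℝ) :=
    LinearMap.toContinuousLinearMap
      { toFun := fun B i j => LinearMap.toMatrix b b (B : V →ₗ[ℝ] V) i j
        map_add' := fun B C => by ext; simp
        map_smul' := fun c B => by ext; simp }
  have hdet : ∀ B : V →L[ℝ] V, LinearMap.det (B : V →ₗ[ℝ] V) = Matrix.det (Matrix.of (L B)) :=
    fun B => (LinearMap.det_toMatrix b _).symm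
  have hdiff : Differentiable ℝ (fun B : V →L[ℝ] V => LinearMap.det (B : V →ₗ[ℝ] V)) := by
    simp only [hdet]
    exact (differentiable_det_matrix _).comp L.differentiable
  have hF := (hdiff (1 : V →L[ℝ] V)).hasFDerivAt
  have h1 : HasDerivAt (fun h : ℝ => (1 : V →L[ℝ] V) + h • A) A 0 := by
    simpa using ((hasDerivAt_id (0 : ℝ)).smul_const A).const_add (1 : V →L[ℝ] V)
  have h2 : HasDerivAt (fun h : ℝ => NormedSpace.exp (h • A)) A 0 := by
    simpa using hasDerivAt_exp_smul_const (𝕂 := ℝ) A (0 : ℝ)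
  have e1 := HasFDerivAt.comp_hasDerivAt_of_eq (0 : ℝ) hF h1 (by simp)
  have e2 := HasFDerivAt.comp_hasDerivAt_of_eq (0 : ℝ) hF h2 (by simp)
  have e3 : HasDerivAt (fun h : ℝ => LinearMap.det (((1 : V →L[ℝ] V) + h • A : V →L[ℝ] V) :
      V →ₗ[ℝ] V)) (LinearMap.trace ℝ V (A : V →ₗ[ℝ] V)) 0 := by
    set M := LinearMap.toMatrix b b (A : V →ₗ[ℝ] V)
    have hp := (Matrix.det (1 + (Polynomial.X : Polynomial ℝ) • M.map Polynomial.C)).hasDerivAt 0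
    rw [Matrix.derivative_det_one_add_X_smul] at hp
    rw [LinearMap.trace_eq_matrix_trace ℝ b]
    refine hp.congr_of_eventuallyEq (Eventually.of_forall fun h => ?_)
    simp only
    rw [← LinearMap.det_toMatrix b, ← Polynomial.coe_evalRingHom, RingHom.map_det]
    congr 1
    ext i j
    by_cases hij : i = j <;> simp [hij, M, LinearMap.toMatrix_one] <;> ring
  rw [← e1.unique e3]
  exact e2

/-- The group law spreads the derivative at 0 to every s: the determinant D satisfies D' = τD, so D
e^{-sτ} is constant. -/
theorem det_exp_smul (A : V →L[ℝ] V) (s : ℝ) :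
    LinearMap.det ((NormedSpace.exp (s • A) : V →L[ℝ] V) : V →ₗ[ℝ] V) =
      Real.exp (s * LinearMap.trace ℝ V (A : V →ₗ[ℝ] V)) := by
  set τ := LinearMap.trace ℝ V (A : V →ₗ[ℝ] V) with hτ
  set D : ℝ → ℝ := fun s => LinearMap.det ((NormedSpace.exp (s • A) : V →L[ℝ] V) : V →ₗ[ℝ] V)
    with hDdef
  have hadd : ∀ s t, D (s + t) = D s * D t := fun s t => by
    simp only [D]
    rw [exp_add_smul, ← LinearMap.det_comp]; rfl
  have h0 : D 0 = 1 := by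
    simp only [D, exp_zero_smul]
    exact LinearMap.det_id
  have hD : ∀ s, HasDerivAt D (D s * τ) s := fun s => by
    have h1 : HasDerivAt (fun t => D s * D (t - s)) (D s * τ) s := by
      have h := hasDerivAt_det_exp_smul A
      rw [← sub_self s] at h
      exact (h.comp_sub_const s s).const_mul (D s)
    refine h1.congr_of_eventuallyEq (Eventually.of_forall fun t => ?_)
    simp only
    rw [← hadd, add_sub_cancel]
  have hd : ∀ s, HasDerivAt (fun s => D s * Real.exp (-(s * τ))) 0 s := fun s => by
    have h2 : HasDerivAt (fun s : ℝ => Real.exp (-(s * τ))) (Real.exp (-(s * τ)) * (-(1 * τ))) s :=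
      (((hasDerivAt_id s).mul_const _).neg).exp
    convert! (hD s).mul h2 using 1
    ring
  have hc := is_const_of_deriv_eq_zero (fun s => (hd s).differentiableAt) (fun s => (hd s).deriv) s 0
  simp only [h0, zero_mul, neg_zero, Real.exp_zero, mul_one, Real.exp_neg] at hc
  change D s = _
  field_simp at hc
  linarith

end OperatorExponential

/-! ### The groups r ↦ r^A. -/

section OneParameterGroup

variable {d : ℕ}

theorem opPow_one (A : End d) : opPow 1 A = 1 := by
  rw [opPow, Real.log_one]; exact exp_zero_smul A

theorem opPow_mul {r s : ℝ} (hr : 0 < r) (hs : 0 < s) (A : End d) :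
    opPow (r * s) A = opPow r A * opPow s A := by
  rw [opPow, Real.log_mul hr.ne' hs.ne']; exact exp_add_smul A _ _

theorem opPow_mul_apply {r s : ℝ} (hr : 0 < r) (hs : 0 < s) (A : End d) (x : E d) :
    opPow (r * s) A x = opPow r A (opPow s A x) := by
  rw [opPow_mul hr hs]; rfl

theorem opPow_inv_apply {r : ℝ} (hr : 0 < r) (A : End d) (x : E d) :
    opPow r⁻¹ A (opPow r A x) = x := by
  rw [← opPow_mul_apply (inv_pos.2 hr) hr, inv_mul_cancel₀ hr.ne', opPow_one]; rfl

theorem opPow_apply_inv {r : ℝ} (hr : 0 < r) (A : End d) (x : E d) :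
    opPow r A (opPow r⁻¹ A x) = x := by
  rw [← opPow_mul_apply hr (inv_pos.2 hr), mul_inv_cancel₀ hr.ne', opPow_one]; rfl

/-- This puts Q, scaled by A, and R, scaled by A/k, on the same orbit: time t for Q is time t^k for
R. -/
theorem opPow_rpow_inv_smul {t k : ℝ} (ht : 0 < t) (hk : k ≠ 0) (A : End d) :
    opPow (t ^ k) (k⁻¹ • A) = opPow t A := by
  rw [opPow, opPow, Real.log_rpow ht]
  congr 1
  refine (smul_smul _ _ A).trans ?_
  congr 1
  field_simp

theorem measurable_opPow_apply (A : End d) :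
    Measurable fun p : ℝ × E d => opPow p.1 A p.2 :=
  (continuous_exp_smul_apply A).measurable.comp
    ((Real.measurable_log.comp measurable_fst).prodMk measurable_snd)

theorem continuous_opPow (r : ℝ) (A : End d) : Continuous fun x => opPow r A x :=
  (opPow r A).continuous

theorem continuousOn_opPow_apply (A : End d) :
    ContinuousOn (fun p : ℝ × E d => opPow p.1 A p.2) (Ioi 0 ×ˢ univ) :=
  (continuous_exp_smul_apply A).comp_continuousOn
    ((Real.continuousOn_log.comp continuousOn_fst
      (fun _ hp => (mem_Ioi.1 hp.1).ne')).prodMk continuousOn_snd)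

theorem hasDerivAt_opPow_apply {r : ℝ} (hr : 0 < r) (A : End d) (x : E d) :
    HasDerivAt (fun s => opPow s A x) (r⁻¹ • A (opPow r A x)) r :=
  (hasDerivAt_exp_smul_apply A (Real.log r) x).scomp r (Real.hasDerivAt_log hr.ne')

theorem contDiffAt_opPow_apply {r : ℝ} (hr : 0 < r) (A : End d) (x : E d) (n : ℕ∞) :
    ContDiffAt ℝ n (fun s => opPow s A x) r :=
  (contDiff_exp_smul_apply A x n).contDiffAt.comp r (Real.contDiffAt_log.2 hr.ne')

theorem IsContracting.eventually_mem {A : End d} (hA : IsContracting A) {K : Set (E d)}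
    (hK : IsCompact K) {U : Set (E d)} (hU : U ∈ 𝓝 (0 : E d)) :
    ∃ δ : ℝ, 0 < δ ∧ ∀ r : ℝ, 0 < r → r < δ → ∀ x ∈ K, opPow r A x ∈ U := by
  obtain ⟨ε, hε, hεU⟩ := Metric.mem_nhds_iff.1 hU
  obtain ⟨M, hM, hMK⟩ := hK.isBounded.exists_pos_norm_le
  have h := hA.eventually (gt_mem_nhds (div_pos hε hM))
  rw [eventually_nhdsWithin_iff] at h
  obtain ⟨δ, hδ, h⟩ := Metric.eventually_nhds_iff.1 h
  refine ⟨δ, hδ, fun r hr hrδ x hx => hεU ?_⟩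
  have h1 := h (y := r) (by simpa [abs_of_pos hr] using hrδ) hr
  rw [mem_ball_zero_iff]
  calc ‖opPow r A x‖ ≤ ‖opPow r A‖ * ‖x‖ := (opPow r A).le_opNorm x
    _ ≤ ‖opPow r A‖ * M := by gcongr; exact hMK x hx
    _ < ε := by rwa [lt_div_iff₀ hM] at h1

theorem det_opPow {r : ℝ} (hr : 0 < r) (A : End d) :
    LinearMap.det (opPow r A : E d →ₗ[ℝ] E d) = r ^ tr A := by
  rw [Real.rpow_def_of_pos hr]
  exact det_exp_smul A (Real.log r)

end OneParameterGroup

/-! ### Positive homogeneous functions: compact sublevel sets and scaling of volume. -/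

section PositiveHomogeneous

variable {d : ℕ} {P : E d → ℝ} {A : End d}

theorem IsPosDef.pos (hP : IsPosDef P) {x : E d} (hx : x ≠ 0) : 0 < P x :=
  lt_of_le_of_ne (hP.1 x) fun h => hx (hP.2 x h.symm)

theorem IsHomogeneousWrt.apply_opPow (hA : IsHomogeneousWrt P A) {r : ℝ} (hr : 0 < r) (x : E d) :
    P (opPow r A x) = r * P x :=
  (hA r hr x).symm

/-- Contraction drags a point x outside the unit ball across the unit sphere at some time r ≤ 1. If
m > 0 bounds P from below on the sphere, homogeneity gives m ≤ r P(x) ≤ rt. So x lies in the image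
of the compact set [1, t/m] × sphere under the flow. -/
theorem IsPositiveHomogeneous.isCompact_sublevel (hP : IsPositiveHomogeneous P) (t : ℝ) :
    IsCompact {x | P x ≤ t} := by
  obtain ⟨A, hA⟩ := hP.nonempty
  have hcl : IsClosed {x | P x ≤ t} := isClosed_le hP.continuous continuous_const
  obtain ⟨m, hm, hmin⟩ := (isCompact_sphere (0 : E d) 1).exists_forall_le'
    hP.continuous.continuousOn (a := 0)
    fun x hx => hP.posDef.pos (norm_ne_zero_iff.1 (by rw [mem_sphere_zero_iff_norm.1 hx]; simp))
  have hK : IsCompact (Metric.closedBall (0 : E d) 1 ∪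
      (fun p : ℝ × E d => opPow p.1 A p.2) '' (Icc 1 (t / m) ×ˢ Metric.sphere (0 : E d) 1)) := by
    refine (isCompact_closedBall _ _).union
      ((isCompact_Icc.prod (isCompact_sphere _ _)).image_of_continuousOn ?_)
    exact (continuousOn_opPow_apply A).mono
      (prod_mono (fun r hr => lt_of_lt_of_le one_pos hr.1) (subset_univ _))
  refine hK.of_isClosed_subset hcl fun x hx => ?_
  by_cases hx1 : ‖x‖ ≤ 1
  · exact Or.inl (mem_closedBall_zero_iff.2 hx1)
  right
  obtain ⟨δ, hδ, hδx⟩ := (hP.contracting A hA).eventually_mem (isCompact_singleton (x := x))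
    (Metric.ball_mem_nhds 0 one_pos)
  set r₀ := min (δ / 2) 1 with hr₀
  have hr₀pos : 0 < r₀ := lt_min (half_pos hδ) one_pos
  have h0 : ‖opPow r₀ A x‖ < 1 := by
    have := hδx r₀ hr₀pos (lt_of_le_of_lt (min_le_left _ _) (half_lt_self hδ)) x rfl
    simpa using this
  have hcont : ContinuousOn (fun r => ‖opPow r A x‖) (Icc r₀ 1) := by
    refine ((continuousOn_opPow_apply A).comp (f := fun r => (r, x))
      (by fun_prop) fun r hr => ?_).norm
    exact ⟨lt_of_lt_of_le hr₀pos hr.1, mem_univ _⟩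
  have h1 : (1 : ℝ) ∈ Icc ‖opPow r₀ A x‖ ‖opPow 1 A x‖ := by
    refine ⟨h0.le, ?_⟩
    rw [opPow_one]; exact (not_le.1 hx1).le
  obtain ⟨r, hr, hr1⟩ := intermediate_value_Icc (min_le_right _ _) hcont h1
  have hrpos : 0 < r := lt_of_lt_of_le hr₀pos hr.1
  have hmr := hmin (opPow r A x) (mem_sphere_zero_iff_norm.2 hr1)
  rw [IsHomogeneousWrt.apply_opPow hA hrpos] at hmr
  refine ⟨(r⁻¹, opPow r A x), ⟨⟨(one_le_inv₀ hrpos).2 hr.2, ?_⟩, mem_sphere_zero_iff_norm.2 hr1⟩,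
    opPow_inv_apply hrpos A x⟩
  change r⁻¹ ≤ t / m
  rw [inv_le_comm₀ hrpos, inv_div, div_le_iff₀]
  · exact hmr.trans (mul_le_mul_of_nonneg_left hx hrpos.le)
  all_goals
    have : 0 < P x := hP.posDef.pos (by rintro rfl; simp at hx1)
    have : 0 < t := this.trans_le hx
    positivity

theorem IsPositiveHomogeneous.map_zero (hP : IsPositiveHomogeneous P) : P 0 = 0 := by
  obtain ⟨A, hA⟩ := hP.nonempty
  have := IsHomogeneousWrt.apply_opPow hA two_pos 0
  rw [_root_.map_zero] at this
  linarith

theorem IsPositiveHomogeneous.apply_opPow_inv_self (hP : IsPositiveHomogeneous P)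
    (hA : A ∈ expSet P) {x : E d} (hx : x ≠ 0) : P (opPow (P x)⁻¹ A x) = 1 := by
  have h := hP.posDef.pos hx
  rw [IsHomogeneousWrt.apply_opPow hA (inv_pos.2 h), inv_mul_cancel₀ h.ne']

/-- Each x ≠ 0 is r^A y with r = P(x) and P(y) = 1. Contraction, uniform on the compact set {P ≤ 1},
therefore becomes a statement about small P(x). -/
theorem IsPositiveHomogeneous.exists_sublevel_subset (hP : IsPositiveHomogeneous P)
    {U : Set (E d)} (hU : U ∈ 𝓝 (0 : E d)) : ∃ b : ℝ, 0 < b ∧ {x | P x < b} ⊆ U := by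
  obtain ⟨A, hA⟩ := hP.nonempty
  obtain ⟨b, hb, h⟩ := (hP.contracting A hA).eventually_mem (hP.isCompact_sublevel 1) hU
  refine ⟨b, hb, fun x hx => ?_⟩
  by_cases hx0 : x = 0
  · exact hx0 ▸ mem_of_mem_nhds hU
  have := h (P x) (hP.posDef.pos hx0) hx (opPow (P x)⁻¹ A x)
    (hP.apply_opPow_inv_self hA hx0).le
  rwa [opPow_apply_inv (hP.posDef.pos hx0)] at this

theorem volume_preimage_opPow {r : ℝ} (hr : 0 < r) (A : End d) (s : Set (E d)) :
    volume ((fun x => opPow r A x) ⁻¹' s) = ENNReal.ofReal (r ^ (-tr A)) * volume s := by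
  have hdet : LinearMap.det (opPow r A : E d →ₗ[ℝ] E d) = r ^ tr A := det_opPow hr A
  have hpos := Real.rpow_pos_of_pos hr (tr A)
  have := Measure.addHaar_preimage_linearMap (volume : Measure (E d))
    (f := (opPow r A : E d →ₗ[ℝ] E d)) (by rw [hdet]; exact hpos.ne') s
  rw [hdet, abs_of_pos (inv_pos.2 hpos), ← Real.rpow_neg hr.le] at this
  exact this

theorem setIntegral_opPow {F : Type*} [NormedAddCommGroup F] [NormedSpace ℝ F] {r : ℝ}
    (hr : 0 < r) (A : End d) (s : Set (E d)) (f : E d → F) :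
    ∫ x in (fun x => opPow r A x) ⁻¹' s, f (opPow r A x) = r ^ (-tr A) • ∫ x in s, f x := by
  have hdet : LinearMap.det (opPow r A : E d →ₗ[ℝ] E d) = r ^ tr A := det_opPow hr A
  have hpos := Real.rpow_pos_of_pos hr (tr A)
  have hmap := Measure.map_linearMap_addHaar_eq_smul_addHaar (volume : Measure (E d))
    (f := (opPow r A : E d →ₗ[ℝ] E d)) (by rw [hdet]; exact hpos.ne')
  rw [hdet, abs_of_pos (inv_pos.2 hpos), ← Real.rpow_neg hr.le] at hmap
  have hemb : MeasurableEmbedding (fun x => opPow r A x) := by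
    refine (Topology.IsClosedEmbedding.of_continuous_injective_isClosedMap
      (continuous_opPow r A) ?_ ?_).measurableEmbedding
    · exact Function.LeftInverse.injective (opPow_inv_apply hr A)
    · exact (Homeomorph.mk ⟨fun x => opPow r A x, fun x => opPow r⁻¹ A x, opPow_inv_apply hr A,
        opPow_apply_inv hr A⟩ (continuous_opPow r A) (continuous_opPow r⁻¹ A)).isClosedMap
  rw [← hemb.setIntegral_map]
  change ∫ x in s, f x ∂(Measure.map (opPow r A : E d →ₗ[ℝ] E d) volume) = _
  rw [hmap, Measure.restrict_smul, integral_smul_measure,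
    ENNReal.toReal_ofReal (Real.rpow_nonneg hr.le _)]

theorem IsHomogeneousWrt.volume_sublevel (hA : IsHomogeneousWrt P A) {t : ℝ}
    (ht : 0 < t) :
    volume {x | P x ≤ t} = ENNReal.ofReal (t ^ tr A) * volume {x | P x ≤ 1} := by
  have h := volume_preimage_opPow (inv_pos.2 ht) A {x | P x ≤ 1}
  rw [Real.inv_rpow ht.le, ← Real.rpow_neg ht.le, neg_neg] at h
  rw [← h]
  congr 1
  ext x
  simp only [mem_ofPred_eq, mem_preimage]
  rw [hA.apply_opPow (inv_pos.2 ht), inv_mul_le_iff₀ ht, mul_one]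

end PositiveHomogeneous

/-! ### Laplace-type bound, oscillatory integrals and generalized polar coordinates. -/

section Estimates

variable {d : ℕ} {P : E d → ℝ} {A : End d}

theorem summable_exp_neg_mul_rpow (τ : ℝ) :
    Summable fun k : ℕ => Real.exp (-(k : ℝ)) * ((k : ℝ) + 1) ^ τ := by
  obtain ⟨N, hN⟩ := exists_nat_ge τ
  have h := (summable_nat_add_iff 1).2 (Real.summable_pow_mul_exp_neg_nat_mul N one_pos)
  refine (h.mul_left (Real.exp 1)).of_nonneg_of_le (fun k => by positivity) fun k => ?_
  have h1 : ((k : ℝ) + 1) ^ τ ≤ ((k : ℝ) + 1) ^ N := by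
    rw [← Real.rpow_natCast]
    exact Real.rpow_le_rpow_of_exponent_le (by linarith [(Nat.cast_nonneg k : (0 : ℝ) ≤ k)]) hN
  have h2 : Real.exp (-(k : ℝ)) = Real.exp 1 * Real.exp (-1 * ((k + 1 : ℕ) : ℝ)) := by
    rw [← Real.exp_add]; congr 1; push_cast; ring
  rw [h2]
  push_cast
  calc _ ≤ Real.exp 1 * Real.exp (-1 * ((k : ℝ) + 1)) * ((k : ℝ) + 1) ^ N := by gcongr
    _ = _ := by ring

/-- With k the integer part of lP(x), the integrand is at most e^{-k} and x lies in {P ≤ (k+1)/l},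
whose volume is a multiple of ((k+1)/l)^{tr A}. Summing over k leaves a convergent series times
l^{-tr A}. -/
theorem IsPositiveHomogeneous.lintegral_exp_neg_le (hP : IsPositiveHomogeneous P)
    (hA : A ∈ expSet P) : ∃ C : ENNReal, C ≠ ⊤ ∧ ∀ l : ℝ, 0 < l →
      ∫⁻ x, ENNReal.ofReal (Real.exp (-(l * P x))) ≤ C * ENNReal.ofReal (l ^ (-tr A)) := by
  refine ⟨(∑' k : ℕ, ENNReal.ofReal (Real.exp (-(k : ℝ)) * ((k : ℝ) + 1) ^ tr A)) *
    volume {x | P x ≤ 1}, ENNReal.mul_ne_top (summable_exp_neg_mul_rpow _).tsum_ofReal_ne_top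
      (hP.isCompact_sublevel 1).measure_lt_top.ne, fun l hl => ?_⟩
  have hmeas : ∀ k : ℕ, MeasurableSet {x | P x ≤ ((k : ℝ) + 1) / l} := fun k =>
    (isClosed_le hP.continuous continuous_const).measurableSet
  calc ∫⁻ x, ENNReal.ofReal (Real.exp (-(l * P x)))
      ≤ ∫⁻ x, ∑' k : ℕ, {x | P x ≤ ((k : ℝ) + 1) / l}.indicator
          (fun _ => ENNReal.ofReal (Real.exp (-(k : ℝ)))) x := by
        refine lintegral_mono fun x => ?_
        have hnn : 0 ≤ l * P x := mul_nonneg hl.le (hP.posDef.1 x)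
        refine le_trans ?_ (ENNReal.le_tsum ⌊l * P x⌋₊)
        rw [indicator_of_mem]
        · exact ENNReal.ofReal_le_ofReal (Real.exp_le_exp.2 (neg_le_neg (Nat.floor_le hnn)))
        · change P x ≤ _
          rw [le_div_iff₀ hl, mul_comm]
          exact (Nat.lt_floor_add_one _).le
    _ = ∑' k : ℕ, ENNReal.ofReal (Real.exp (-(k : ℝ))) * volume {x | P x ≤ ((k : ℝ) + 1) / l} := by
        rw [lintegral_tsum fun k => (measurable_const.indicator (hmeas k)).aemeasurable]
        congr 1; ext k
        rw [lintegral_indicator_const (hmeas k)]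
    _ = ∑' k : ℕ, ENNReal.ofReal (Real.exp (-(k : ℝ)) * ((k : ℝ) + 1) ^ tr A) *
          (volume {x | P x ≤ 1} * ENNReal.ofReal (l ^ (-tr A))) := by
        congr 1; ext k
        have hk : (0 : ℝ) < (k : ℝ) + 1 := by positivity
        rw [IsHomogeneousWrt.volume_sublevel hA (div_pos hk hl), Real.div_rpow hk.le hl.le,
          div_eq_mul_inv, ← Real.rpow_neg hl.le, ENNReal.ofReal_mul (by positivity),
          ENNReal.ofReal_mul (by positivity)]
        ring
    _ = _ := by rw [ENNReal.tsum_mul_right, mul_assoc]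

/-- Integration by parts against v = g/(iθ'). The two boundary terms are each at most (D/l)a^{μ-1},
which gives the 2. The remaining integrand is at most (D/l)(1+M)t^{μ-2}, whose integral from a is at
most (D/l)(1+M)a^{μ-1}/(1-μ) since μ < 1. -/
theorem norm_integral_exp_I_mul_le {a b B μ l M D : ℝ} (ha : 0 < a) (hab : a ≤ b) (hb : b < B)
    (hμ : μ < 1) (hl : 0 < l) (hM : 0 ≤ M) (hD : 0 ≤ D) {θ θ' θ'' : ℝ → ℝ} {g g' : ℝ → ℂ}
    (hθ : ∀ t ∈ Ioo 0 B, HasDerivAt θ (θ' t) t) (hθ' : ∀ t ∈ Ioo 0 B, HasDerivAt θ' (θ'' t) t)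
    (hg : ∀ t ∈ Ioo 0 B, HasDerivAt g (g' t) t)
    (hθl : ∀ t ∈ Ioo 0 B, l ≤ |θ' t|) (hθM : ∀ t ∈ Ioo 0 B, |θ'' t| ≤ M * l / t)
    (hgD : ∀ t ∈ Ioo 0 B, ‖g t‖ ≤ D * t ^ (μ - 1))
    (hgD' : ∀ t ∈ Ioo 0 B, ‖g' t‖ ≤ D * t ^ (μ - 2)) :
    ‖∫ t in a..b, Complex.exp (Complex.I * θ t) * g t‖ ≤
      D / l * (2 + (1 + M) / (1 - μ)) * a ^ (μ - 1) := by
  have hμ' : 0 < 1 - μ := by linarith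
  have hsub : Icc a b ⊆ Ioo 0 B := fun t ht => ⟨ha.trans_le ht.1, ht.2.trans_lt hb⟩
  have hne : ∀ t ∈ Ioo 0 B, (θ' t : ℂ) ≠ 0 := fun t ht h0 => by
    have := hθl t ht
    rw [Complex.ofReal_eq_zero.1 h0, abs_zero] at this
    linarith
  have hnl : ∀ t ∈ Ioo 0 B, l ≤ ‖(θ' t : ℂ)‖ := fun t ht => by
    rw [Complex.norm_real, Real.norm_eq_abs]
    exact hθl t ht
  set h : ℝ → ℂ := fun t => Complex.exp (Complex.I * θ t) * g t with hh
  set w : ℝ → ℂ := fun t => Complex.exp (Complex.I * θ t) * (g t / (Complex.I * θ' t)) with hw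
  have hexp : ∀ t, ‖Complex.exp (Complex.I * θ t)‖ = 1 := fun t => by
    rw [mul_comm]; exact Complex.norm_exp_ofReal_mul_I _
  have hexpd : ∀ t ∈ Ioo 0 B, HasDerivAt (fun t => Complex.exp (Complex.I * θ t))
      (Complex.exp (Complex.I * θ t) * (Complex.I * θ' t)) t := fun t ht =>
    ((hθ t ht).ofReal_comp.const_mul Complex.I).cexp
  set v' : ℝ → ℂ := fun t =>
    (g' t * (Complex.I * θ' t) - g t * (Complex.I * θ'' t)) / (Complex.I * θ' t) ^ 2 with hv'
  have hwd : ∀ t ∈ Ioo 0 B, HasDerivAt w (h t + Complex.exp (Complex.I * θ t) * v' t) t :=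
    fun t ht => by
      have h1 := (hexpd t ht).mul ((hg t ht).div ((hθ' t ht).ofReal_comp.const_mul Complex.I)
        (mul_ne_zero Complex.I_ne_zero (hne t ht)))
      convert! h1 using 1
      simp only [hh, hv', Pi.div_apply]
      have := hne t ht
      field_simp
  have hv'le : ∀ t ∈ Ioo 0 B, ‖v' t‖ ≤ D / l * (1 + M) * t ^ (μ - 2) := fun t ht => by
    have ht0 : 0 < t := ht.1
    have e : v' t = g' t * (Complex.I * θ' t)⁻¹ -
        g t * (Complex.I * θ'' t) * ((Complex.I * θ' t)⁻¹ * (Complex.I * θ' t)⁻¹) := by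
      simp only [hv']
      have := hne t ht
      field_simp
    have e2 : t ^ (μ - 1) / t = t ^ (μ - 2) := by
      rw [← Real.rpow_sub_one ht0.ne']; congr 1; ring
    rw [e]
    refine (norm_sub_le _ _).trans ?_
    simp only [norm_mul, norm_inv, Complex.norm_I, one_mul]
    have n2 : ‖(θ'' t : ℂ)‖ ≤ M * l / t := by
      rw [Complex.norm_real]; exact hθM t ht
    calc ‖g' t‖ * ‖(θ' t : ℂ)‖⁻¹ + ‖g t‖ * ‖(θ'' t : ℂ)‖ * (‖(θ' t : ℂ)‖⁻¹ * ‖(θ' t : ℂ)‖⁻¹)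
        ≤ D * t ^ (μ - 2) * l⁻¹ + D * t ^ (μ - 1) * (M * l / t) * (l⁻¹ * l⁻¹) := by
          gcongr
          · exact hgD' t ht
          · exact hnl t ht
          · exact hgD t ht
          · exact hnl t ht
          · exact hnl t ht
      _ = D / l * t ^ (μ - 2) + D / l * M * (t ^ (μ - 1) / t) := by field_simp
      _ = _ := by rw [e2]; ring
  have hwle : ∀ t ∈ Icc a b, ‖w t‖ ≤ D / l * a ^ (μ - 1) := fun t ht => by
    have ht' := hsub ht
    simp only [hw, norm_mul, norm_div, hexp, Complex.norm_I, one_mul]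
    rw [div_eq_mul_inv]
    calc ‖g t‖ * ‖(θ' t : ℂ)‖⁻¹ ≤ (D * t ^ (μ - 1)) * l⁻¹ := by
          gcongr
          · exact (norm_nonneg _).trans (hgD t ht')
          · exact hgD t ht'
          · exact hnl t ht'
      _ ≤ (D * a ^ (μ - 1)) * l⁻¹ := by
          gcongr ?_ * _
          exact mul_le_mul_of_nonneg_left
            (Real.rpow_le_rpow_of_nonpos ha ht.1 (by linarith)) hD
      _ = _ := by ring
  have hhc : ContinuousOn h (Ioo 0 B) := fun t ht =>
    ((hexpd t ht).mul (hg t ht)).continuousAt.continuousWithinAt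
  -- The error left by the parts formula is compared with a primitive of its bound through the mean
  -- value inequality, so `g'` and `θ''` need not be integrable.
  have hWd : ∀ t ∈ Icc a b, HasDerivAt (fun t => (∫ s in a..t, h s) - w t + w a)
      (-(Complex.exp (Complex.I * θ t) * v' t)) t := fun t ht => by
    have hint : IntervalIntegrable h volume a t := by
      refine (hhc.mono ?_).intervalIntegrable
      rw [uIcc_of_le ht.1]
      exact (Icc_subset_Icc_right ht.2).trans hsub
    have h1 := intervalIntegral.integral_hasDerivAt_right hint
      (hhc.stronglyMeasurableAtFilter isOpen_Ioo t (hsub ht))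
      (hhc.continuousAt (isOpen_Ioo.mem_nhds (hsub ht)))
    convert! (h1.sub (hwd t (hsub ht))).add_const (w a) using 1
    ring
  have hBd : ∀ t ∈ Icc a b, HasDerivAt
      (fun t => D / l * (1 + M) * ((a ^ (μ - 1) - t ^ (μ - 1)) / (1 - μ)))
      (D / l * (1 + M) * t ^ (μ - 2)) t := fun t ht => by
    have h1 := (((Real.hasDerivAt_rpow_const (p := μ - 1)
      (Or.inl (hsub ht).1.ne')).const_sub (a ^ (μ - 1))).div_const (1 - μ)).const_mul
        (D / l * (1 + M))
    convert! h1 using 1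
    rw [show μ - 1 - 1 = μ - 2 by ring]
    field_simp
    ring
  have hkey := image_norm_le_of_norm_deriv_right_le_deriv_boundary'
    (fun t ht => (hWd t ht).continuousAt.continuousWithinAt)
    (fun t ht => (hWd t (Ico_subset_Icc_self ht)).hasDerivWithinAt)
    (by simp) (fun t ht => (hBd t ht).continuousAt.continuousWithinAt)
    (fun t ht => (hBd t (Ico_subset_Icc_self ht)).hasDerivWithinAt)
    (fun t ht => by
      rw [norm_neg, norm_mul, hexp, one_mul]
      exact hv'le t (hsub (Ico_subset_Icc_self ht))) (right_mem_Icc.2 hab)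
  have e : ∫ t in a..b, h t = ((∫ t in a..b, h t) - w b + w a) + w b - w a := by ring
  rw [e]
  refine (norm_sub_le _ _).trans ((add_le_add_left (norm_add_le _ _) _).trans ?_)
  have h1 := hwle a (left_mem_Icc.2 hab)
  have h2 := hwle b (right_mem_Icc.2 hab)
  have h3 : D / l * (1 + M) * ((a ^ (μ - 1) - b ^ (μ - 1)) / (1 - μ)) ≤
      D / l * (1 + M) * (a ^ (μ - 1) / (1 - μ)) := by
    gcongr
    linarith [Real.rpow_nonneg (ha.le.trans hab) (μ - 1)]
  calc _ ≤ D / l * (1 + M) * (a ^ (μ - 1) / (1 - μ)) + D / l * a ^ (μ - 1)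
        + D / l * a ^ (μ - 1) := by
        linarith
    _ = _ := by ring

/-- Polar coordinates without a surface measure: the thick shell {1 ≤ P < 2} replaces the level set
{P = 1}. For fixed t the substitution x = t^A y turns the weight t^{tr A - 1} into 1/t. For fixed x
the admissible t then fill (P(x)/2, P(x)], over which dt/t integrates to log 2. -/
theorem IsPositiveHomogeneous.setIntegral_annulus_eq (hP : IsPositiveHomogeneous P)
    (hA : A ∈ expSet P) {f : E d → ℂ} (hf : Continuous f) (hf1 : ∀ x, ‖f x‖ ≤ 1) {a b : ℝ}
    (ha : 0 < a) :
    (Real.log 2 : ℂ) * ∫ x in {x | a ≤ P x ∧ P x < b}, f x =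
      ∫ y in {y | 1 ≤ P y ∧ P y < 2}, ∫ t in Ico (a / P y) (b / P y),
        ((t ^ (tr A - 1) : ℝ) : ℂ) * f (opPow t A y) := by
  have hle : ∀ c : ℝ, IsClosed {x | c ≤ P x} := fun c => isClosed_le continuous_const hP.continuous
  have hmeas : ∀ c c' : ℝ, MeasurableSet {x | c ≤ P x ∧ P x < c'} := fun c c' =>
    (hle c).measurableSet.inter (isOpen_lt hP.continuous continuous_const).measurableSet
  have hfin : ∀ c c' : ℝ, volume {x | c ≤ P x ∧ P x < c'} ≠ ⊤ := fun c c' =>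
    ((measure_mono fun x hx => hx.2.le).trans_lt (hP.isCompact_sublevel c').measure_lt_top).ne
  set S := {y | 1 ≤ P y ∧ P y < 2} with hS
  set T := {x | a ≤ P x ∧ P x < b} with hT
  -- As 1 ≤ P(y) < 2 on the shell, this interval contains every [a/P(y), b/P(y)) and stays away from
  -- 0. It makes the domain a product, as Fubini requires.
  set J := Ioo (a / 2) b with hJ
  have : IsFiniteMeasure (volume.restrict S) := ⟨by simpa using (hfin 1 2).lt_top⟩
  have : IsFiniteMeasure (volume.restrict T) := ⟨by simpa using (hfin a b).lt_top⟩
  have hJint : ∀ p : ℝ, IntegrableOn (fun t : ℝ => t ^ p) J := fun p => by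
    refine IntegrableOn.mono_set (t := Icc (a / 2) b) ?_ Ioo_subset_Icc_self
    refine ContinuousOn.integrableOn_Icc fun t ht => ?_
    exact (Real.continuousAt_rpow_const _ _
      (Or.inl (lt_of_lt_of_le (half_pos ha) ht.1).ne')).continuousWithinAt
  have hJpos : ∀ t ∈ J, 0 < t := fun t ht => (half_pos ha).trans ht.1
  have hPo : ∀ t, 0 < t → ∀ y, P (opPow t A y) = t * P y := fun t ht y =>
    IsHomogeneousWrt.apply_opPow hA ht y
  have hinner : ∀ y ∈ S, ∫ t in Ico (a / P y) (b / P y),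
        ((t ^ (tr A - 1) : ℝ) : ℂ) * f (opPow t A y) =
      ∫ t in J, ((t ^ (tr A - 1) : ℝ) : ℂ) * T.indicator f (opPow t A y) := fun y hy => by
    have hy0 : 0 < P y := one_pos.trans_le hy.1
    have hsubJ : Ico (a / P y) (b / P y) ⊆ J := fun t ht => by
      have ht0 : 0 < t := (div_pos ha hy0).trans_le ht.1
      have h1 := (div_le_iff₀ hy0).1 ht.1
      have h2 := (lt_div_iff₀ hy0).1 ht.2
      constructor
      · nlinarith [hy.2]
      · nlinarith [hy.1]
    have : ∀ t ∈ J, ((t ^ (tr A - 1) : ℝ) : ℂ) * T.indicator f (opPow t A y) =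
        (Ico (a / P y) (b / P y)).indicator
          (fun t => ((t ^ (tr A - 1) : ℝ) : ℂ) * f (opPow t A y)) t := fun t ht => by
      have hiff : opPow t A y ∈ T ↔ t ∈ Ico (a / P y) (b / P y) := by
        rw [hT, mem_ofPred_eq, hPo t (hJpos t ht), mem_Ico, div_le_iff₀ hy0, lt_div_iff₀ hy0]
      by_cases hm : t ∈ Ico (a / P y) (b / P y)
      · rw [indicator_of_mem hm, indicator_of_mem (hiff.2 hm)]
      · rw [indicator_of_notMem hm, indicator_of_notMem (mt hiff.1 hm), mul_zero]
    rw [setIntegral_congr_fun measurableSet_Ioo this, setIntegral_indicator measurableSet_Ico,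
      inter_eq_self_of_subset_right hsubJ]
  rw [setIntegral_congr_fun (hmeas 1 2) hinner]
  have hfT : Measurable (T.indicator f) := hf.measurable.indicator (hmeas a b)
  have hfT1 : ∀ x, ‖T.indicator f x‖ ≤ 1 := fun x =>
    (norm_indicator_le_norm_self f x).trans (hf1 x)
  have hint1 : Integrable (Function.uncurry fun (y : E d) (t : ℝ) =>
      ((t ^ (tr A - 1) : ℝ) : ℂ) * T.indicator f (opPow t A y))
      ((volume.restrict S).prod (volume.restrict J)) := by
    have hb : Integrable (fun p : E d × ℝ => (1 : ℝ) * p.2 ^ (tr A - 1))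
        ((volume.restrict S).prod (volume.restrict J)) :=
      Integrable.mul_prod (f := fun _ => (1 : ℝ)) (integrable_const 1) (hJint _)
    refine hb.mono' ?_ ?_
    · refine Measurable.aestronglyMeasurable ?_
      refine Measurable.mul ?_ (hfT.comp ((measurable_opPow_apply A).comp measurable_swap))
      exact Complex.measurable_ofReal.comp (measurable_snd.pow_const _)
    · have : ∀ᵐ p : E d × ℝ ∂((volume.restrict S).prod (volume.restrict J)), p.2 ∈ J :=
        Measure.quasiMeasurePreserving_snd.ae (ae_restrict_mem measurableSet_Ioo)
      filter_upwards [this] with p hp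
      simp only [Function.uncurry, norm_mul, Complex.norm_real, one_mul]
      rw [Real.norm_of_nonneg (Real.rpow_nonneg (hJpos _ hp).le _)]
      exact mul_le_of_le_one_right (Real.rpow_nonneg (hJpos _ hp).le _) (hfT1 _)
  rw [integral_integral_swap hint1]
  have hslice : ∀ t ∈ J, ∫ y in S, ((t ^ (tr A - 1) : ℝ) : ℂ) * T.indicator f (opPow t A y) =
      ∫ x in T, ((t⁻¹ : ℝ) : ℂ) * {x | t ≤ P x ∧ P x < 2 * t}.indicator f x := fun t ht => by
    have ht0 := hJpos t ht
    have hpre : S = (fun y => opPow t A y) ⁻¹' {x | t ≤ P x ∧ P x < 2 * t} := by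
      ext y
      simp only [hS, mem_ofPred_eq, mem_preimage, hPo t ht0]
      constructor
      · rintro ⟨h1, h2⟩; constructor <;> nlinarith
      · rintro ⟨h1, h2⟩
        exact ⟨le_of_mul_le_mul_left (by linarith) ht0, lt_of_mul_lt_mul_left (by linarith) ht0.le⟩
    rw [integral_const_mul, integral_const_mul, hpre, setIntegral_opPow ht0,
      setIntegral_indicator (hmeas _ _), setIntegral_indicator (hmeas _ _), inter_comm,
      Complex.real_smul, ← mul_assoc, ← Complex.ofReal_mul, ← Real.rpow_add ht0,
      ← Real.rpow_neg_one]
    congr 3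
    ring
  rw [setIntegral_congr_fun measurableSet_Ioo hslice]
  have hint2 : Integrable (Function.uncurry fun (t : ℝ) (x : E d) =>
      ((t⁻¹ : ℝ) : ℂ) * {x | t ≤ P x ∧ P x < 2 * t}.indicator f x)
      ((volume.restrict J).prod (volume.restrict T)) := by
    have hb : Integrable (fun p : ℝ × E d => p.1 ^ (-1 : ℝ) * (1 : ℝ))
        ((volume.restrict J).prod (volume.restrict T)) :=
      Integrable.mul_prod (g := fun _ => (1 : ℝ)) (hJint _) (integrable_const 1)
    refine hb.mono' ?_ ?_
    · refine Measurable.aestronglyMeasurable ?_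
      have hPm : Measurable fun p : ℝ × E d => P p.2 := hP.continuous.measurable.comp measurable_snd
      have hset : MeasurableSet {p : ℝ × E d | p.1 ≤ P p.2 ∧ P p.2 < 2 * p.1} :=
        (measurableSet_le measurable_fst hPm).inter
          (measurableSet_lt hPm (measurable_fst.const_mul 2))
      refine Measurable.mul (Complex.measurable_ofReal.comp measurable_fst.inv) ?_
      have := (hf.measurable.comp (measurable_snd (α := ℝ))).indicator hset
      convert! this using 1
    · have : ∀ᵐ p : ℝ × E d ∂((volume.restrict J).prod (volume.restrict T)), p.1 ∈ J :=
        Measure.quasiMeasurePreserving_fst.ae (ae_restrict_mem measurableSet_Ioo)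
      filter_upwards [this] with p hp
      have hp0 := hJpos _ hp
      simp only [Function.uncurry, norm_mul, Complex.norm_real]
      rw [Real.norm_of_nonneg (inv_nonneg.2 hp0.le), Real.rpow_neg_one]
      gcongr
      exact (norm_indicator_le_norm_self f _).trans (hf1 _)
  rw [integral_integral_swap hint2, ← integral_const_mul]
  refine setIntegral_congr_fun (hmeas a b) fun x hx => ?_
  have hx0 : 0 < P x := ha.trans_le hx.1
  have hind : ∀ t ∈ J, ((t⁻¹ : ℝ) : ℂ) * {x | t ≤ P x ∧ P x < 2 * t}.indicator f x =
      (Ioc (P x / 2) (P x)).indicator (fun t => ((t⁻¹ : ℝ) : ℂ) * f x) t := fun t _ => by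
    have hiff : x ∈ {x | t ≤ P x ∧ P x < 2 * t} ↔ t ∈ Ioc (P x / 2) (P x) := by
      rw [mem_ofPred_eq, mem_Ioc, div_lt_iff₀ two_pos, and_comm, mul_comm]
    by_cases hm : t ∈ Ioc (P x / 2) (P x)
    · rw [indicator_of_mem hm, indicator_of_mem (hiff.2 hm)]
    · rw [indicator_of_notMem hm, indicator_of_notMem (mt hiff.1 hm), mul_zero]
  have hsubJ : Ioc (P x / 2) (P x) ⊆ J := fun t ht =>
    ⟨lt_of_le_of_lt (by linarith [hx.1]) ht.1, ht.2.trans_lt hx.2⟩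
  rw [setIntegral_congr_fun measurableSet_Ioo hind, setIntegral_indicator measurableSet_Ioc,
    inter_eq_self_of_subset_right hsubJ, integral_mul_const, integral_complex_ofReal]
  congr 2
  rw [← intervalIntegral.integral_of_le (by linarith), integral_inv_of_pos (half_pos hx0) hx0]
  congr 1
  field_simp

theorem IsPositiveHomogeneous.norm_setIntegral_annulus_le (hP : IsPositiveHomogeneous P)
    (hA : A ∈ expSet P) {f : E d → ℂ} (hf : Continuous f) (hf1 : ∀ x, ‖f x‖ ≤ 1) {a b M : ℝ}
    (ha : 0 < a) (hab : a ≤ b)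
    (hM : ∀ y, 1 ≤ P y → P y < 2 →
      ‖∫ t in (a / P y)..(b / P y), ((t ^ (tr A - 1) : ℝ) : ℂ) * f (opPow t A y)‖ ≤ M) :
    ‖∫ x in {x | a ≤ P x ∧ P x < b}, f x‖ ≤
      M * volume.real {y | 1 ≤ P y ∧ P y < 2} / Real.log 2 := by
  have hlog : 0 < Real.log 2 := Real.log_pos one_lt_two
  have h := congrArg norm (hP.setIntegral_annulus_eq hA hf hf1 (b := b) ha)
  rw [norm_mul, Complex.norm_real, Real.norm_of_nonneg hlog.le] at h
  rw [le_div_iff₀ hlog, mul_comm, h]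
  refine norm_setIntegral_le_of_norm_le_const ?_ fun y hy => ?_
  · exact (measure_mono fun x hx => hx.2.le).trans_lt (hP.isCompact_sublevel 2).measure_lt_top
  · have hy0 : 0 < P y := one_pos.trans_le hy.1
    rw [integral_Ico_eq_integral_Ioc, ← intervalIntegral.integral_of_le (by gcongr)]
    exact hM y hy.1 hy.2

end Estimates

/-! ### Local analysis at a point of maximal modulus; points of positive homogeneous type. -/

section Local

variable {d : ℕ} {P : E d → ℝ} {A : End d} {φ : (Fin d → ℤ) → ℂ} {ξ₀ : E d} {μ : ℝ}

/-- The integrand in the Fourier inversion formula for the convolution powers. -/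
noncomputable def inversionKernel (φ : (Fin d → ℤ) → ℂ) (n : ℕ) (x : Fin d → ℤ) (ξ : E d) : ℂ :=
  fourier φ ξ ^ n * Complex.exp (-(Complex.I * ((inner ℝ (latticePt x) ξ : ℝ) : ℂ)))

theorem norm_exp_neg_I_mul (s : ℝ) : ‖Complex.exp (-(Complex.I * (s : ℂ)))‖ = 1 := by
  rw [show -(Complex.I * (s : ℂ)) = ((-s : ℝ) : ℂ) * Complex.I by push_cast; ring]
  exact Complex.norm_exp_ofReal_mul_I _

theorem norm_inversionKernel (φ : (Fin d → ℤ) → ℂ) (n : ℕ) (x : Fin d → ℤ) (ξ : E d) :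
    ‖inversionKernel φ n x ξ‖ = ‖fourier φ ξ‖ ^ n := by
  rw [inversionKernel, norm_mul, norm_exp_neg_I_mul, mul_one, norm_pow]

theorem continuous_inversionKernel (hc : Continuous (fourier φ)) (n : ℕ) (x : Fin d → ℤ) :
    Continuous (inversionKernel φ n x) := by
  unfold inversionKernel
  fun_prop

/-- The integrals of the inversion kernels over arbitrarily small neighbourhoods of `ξ₀` decay
like `n ^ (-μ)`. -/
def HasLocalDecay (φ : (Fin d → ℤ) → ℂ) (x : Fin d → ℤ) (ξ₀ : E d) (μ : ℝ) : Prop :=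
  ∀ W ∈ 𝓝 ξ₀, ∃ N ⊆ W, IsOpen N ∧ ξ₀ ∈ N ∧ ∃ C : ℝ, ∀ n : ℕ, 1 ≤ n →
    ‖∫ ξ in N, inversionKernel φ n x ξ‖ ≤ C * (n : ℝ) ^ (-μ)

theorem IsExpansion.fourier_eq {U : Set (E d)} {Q R : MvPolynomial (Fin d) ℝ} {Q' R' : E d → ℝ}
    (h : IsExpansion φ ξ₀ U Q R Q' R') (hξ₀ : ‖fourier φ ξ₀‖ = 1) {ξ : E d} (hξ : ξ ∈ U) :
    fourier φ (ξ + ξ₀) = fourier φ ξ₀ *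
      Complex.exp (Complex.I * ((inner ℝ (drift φ ξ₀) ξ : ℝ) : ℂ)
        - Complex.I * ((polyFun Q ξ + Q' ξ : ℝ) : ℂ) - ((polyFun R ξ + R' ξ : ℝ) : ℂ)) := by
  rw [← h.eq ξ hξ, logRatio, Complex.exp_log (Complex.slitPlane_ne_zero (h.mem_slitPlane ξ hξ)),
    mul_div_cancel₀]
  rw [← norm_ne_zero_iff, hξ₀]
  exact one_ne_zero

theorem IsExpansion.norm_fourier_eq {U : Set (E d)} {Q R : MvPolynomial (Fin d) ℝ}
    {Q' R' : E d → ℝ} (h : IsExpansion φ ξ₀ U Q R Q' R') (hξ₀ : ‖fourier φ ξ₀‖ = 1) {ξ : E d}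
    (hξ : ξ ∈ U) : ‖fourier φ (ξ + ξ₀)‖ = Real.exp (-(polyFun R ξ + R' ξ)) := by
  rw [h.fourier_eq hξ₀ hξ, norm_mul, hξ₀, one_mul, Complex.norm_exp]
  simp

theorem IsPositiveHomogeneous.exists_abs_le_mul (hP : IsPositiveHomogeneous P)
    (hA : A ∈ expSet P) {f : E d → ℝ}
    (hf : ∀ ε : ℝ, 0 < ε → ∀ K : Set (E d), IsCompact K → ∃ δ : ℝ, 0 < δ ∧
      ∀ r : ℝ, 0 < r → r < δ → ∀ x ∈ K, |f (opPow r A x)| ≤ ε * r) {ε : ℝ} (hε : 0 < ε) :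
    ∃ b : ℝ, 0 < b ∧ ∀ x, x ≠ 0 → P x < b → |f x| ≤ ε * P x := by
  obtain ⟨δ, hδ, h⟩ := hf ε hε _ (hP.isCompact_sublevel 1)
  refine ⟨δ, hδ, fun x hx hxδ => ?_⟩
  have hpos := hP.posDef.pos hx
  have := h (P x) hpos hxδ (opPow (P x)⁻¹ A x) (hP.apply_opPow_inv_self hA hx).le
  rwa [opPow_apply_inv hpos] at this

theorem contDiffAt_comp_opPow {f : E d → ℝ} {U : Set (E d)} (hU : IsOpen U)
    (hf : ContDiffOn ℝ ∞ f U) (A : End d) {r : ℝ} (hr : 0 < r) {x : E d} (hx : opPow r A x ∈ U) :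
    ContDiffAt ℝ ∞ (fun s => f (opPow s A x)) r :=
  (hf.contDiffAt (hU.mem_nhds hx)).comp r (contDiffAt_opPow_apply hr A x ⊤)

theorem IsStronglySubhomogeneous.abs_deriv_le {l : ℕ} {U : Set (E d)} {f : E d → ℝ}
    (hl : 1 ≤ l) (h : IsStronglySubhomogeneous l U f A) {ε : ℝ} (hε : 0 < ε) {K : Set (E d)}
    (hK : IsCompact K) : ∃ δ : ℝ, 0 < δ ∧ ∀ r : ℝ, 0 < r → r < δ → ∀ x ∈ K,
      |deriv (fun s : ℝ => f (opPow s A x)) r| ≤ ε := by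
  obtain ⟨δ, hδ, h⟩ := h.2 ε hε K hK
  refine ⟨δ, hδ, fun r hr hrδ x hx => ?_⟩
  have := h 1 le_rfl hl r hr hrδ x hx
  rw [pow_one, iteratedDeriv_one, abs_mul, abs_of_pos hr, mul_comm] at this
  exact le_of_mul_le_mul_right this hr

/-- Strong subhomogeneity controls only derivatives in r. As f(s^A x) tends to f(0) = 0 when s → 0,
the mean value inequality turns the bound ε on the first derivative into εr. -/
theorem IsStronglySubhomogeneous.abs_le {l : ℕ} {U : Set (E d)} {f : E d → ℝ}
    (hl : 1 ≤ l) (h : IsStronglySubhomogeneous l U f A) (hA : IsContracting A) (hU : IsOpen U)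
    (h0 : (0 : E d) ∈ U) (hf : ContDiffOn ℝ ∞ f U) (hf0 : f 0 = 0) {ε : ℝ} (hε : 0 < ε)
    {K : Set (E d)} (hK : IsCompact K) : ∃ δ : ℝ, 0 < δ ∧ ∀ r : ℝ, 0 < r → r < δ → ∀ x ∈ K,
      |f (opPow r A x)| ≤ ε * r := by
  obtain ⟨δ₁, hδ₁, h1⟩ := h.abs_deriv_le hl hε hK
  obtain ⟨δ₂, hδ₂, h2⟩ := hA.eventually_mem hK (hU.mem_nhds h0)
  refine ⟨min δ₁ δ₂, lt_min hδ₁ hδ₂, fun r hr hrδ x hx => ?_⟩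
  have hd : ∀ s ∈ Ioo 0 (min δ₁ δ₂), DifferentiableAt ℝ (fun s => f (opPow s A x)) s :=
    fun s hs => (contDiffAt_comp_opPow hU hf A hs.1
      (h2 s hs.1 (hs.2.trans_le (min_le_right _ _)) x hx)).differentiableAt (by simp)
  have hlip : ∀ s ∈ Ioo 0 r, |f (opPow r A x) - f (opPow s A x)| ≤ ε * r := fun s hs => by
    have := (convex_Ioo 0 (min δ₁ δ₂)).norm_image_sub_le_of_norm_deriv_le
      (f := fun s => f (opPow s A x)) hd
      (fun u hu => h1 u hu.1 (hu.2.trans_le (min_le_left _ _)) x hx)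
      ⟨hs.1, hs.2.trans hrδ⟩ ⟨hr, hrδ⟩
    refine (this : |_| ≤ _).trans (mul_le_mul_of_nonneg_left ?_ hε.le)
    rw [Real.norm_of_nonneg (by linarith [hs.2])]
    linarith [hs.1]
  have hlim : Tendsto (fun s => opPow s A x) (𝓝[>] 0) (𝓝 0) := by
    refine squeeze_zero_norm (fun s => (opPow s A).le_opNorm x) ?_
    simpa using hA.mul_const ‖x‖
  have hlim2 : Tendsto (fun s => f (opPow s A x)) (𝓝[>] 0) (𝓝 0) := by
    have := (hf.contDiffAt (hU.mem_nhds h0)).continuousAt.tendsto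
    rw [hf0] at this
    exact this.comp hlim
  have hlim3 : Tendsto (fun s => |f (opPow r A x) - f (opPow s A x)|) (𝓝[>] 0)
      (𝓝 |f (opPow r A x)|) := by
    simpa using (hlim2.const_sub (f (opPow r A x))).abs
  exact le_of_tendsto hlim3 (by filter_upwards [Ioo_mem_nhdsGT hr] with s hs using hlip s hs)

/-- The modulus is exp(-(R + R')) ≤ exp(-R/2), and R is positive off 0. -/
theorem eventually_norm_fourier_lt_one {U : Set (E d)} {Q R : MvPolynomial (Fin d) ℝ}
    {Q' R' : E d → ℝ} (h : IsExpansion φ ξ₀ U Q R Q' R') (hξ₀ : ‖fourier φ ξ₀‖ = 1)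
    (hR : IsPositiveHomogeneous (polyFun R)) {b : ℝ} (hb : 0 < b)
    (hR' : ∀ ξ, ξ ≠ 0 → polyFun R ξ < b → |R' ξ| ≤ 1 / 2 * polyFun R ξ) :
    ∀ᶠ ξ in 𝓝 ξ₀, ξ ≠ ξ₀ → ‖fourier φ ξ‖ < 1 := by
  have hopen : U ∩ {ξ | polyFun R ξ < b} ∈ 𝓝 (0 : E d) :=
    (h.isOpen.inter (isOpen_lt hR.continuous continuous_const)).mem_nhds
      ⟨h.zero_mem, by rw [mem_ofPred_eq, hR.map_zero]; exact hb⟩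
  have hsub : Tendsto (fun ξ : E d => ξ - ξ₀) (𝓝 ξ₀) (𝓝 0) := by
    have : Continuous fun ξ : E d => ξ - ξ₀ := by fun_prop
    simpa using this.tendsto ξ₀
  filter_upwards [hsub hopen] with ξ hξ hne
  have hne' : ξ - ξ₀ ≠ 0 := sub_ne_zero.2 hne
  have := h.norm_fourier_eq hξ₀ hξ.1
  rw [sub_add_cancel] at this
  rw [this, Real.exp_lt_one_iff]
  have h1 := (abs_le.1 (hR' _ hne' hξ.2)).1
  have h2 := hR.posDef.pos hne'
  linarith

theorem HasPositiveHomogeneousType.eventually_norm_fourier_lt_one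
    (h : HasPositiveHomogeneousType φ ξ₀ μ) (hξ₀ : ‖fourier φ ξ₀‖ = 1) :
    ∀ᶠ ξ in 𝓝 ξ₀, ξ ≠ ξ₀ → ‖fourier φ ξ‖ < 1 := by
  obtain ⟨U, Q, R, Q', R', hE, hR, A, hA, -, hR', -, -⟩ := h
  obtain ⟨b, hb, hbR⟩ := hR.exists_abs_le_mul hA hR'.2 one_half_pos
  exact ConvPower.eventually_norm_fourier_lt_one hE hξ₀ hR hb hbR

theorem HasImaginaryHomogeneousType.eventually_norm_fourier_lt_one
    (h : HasImaginaryHomogeneousType φ ξ₀ μ) (hξ₀ : ‖fourier φ ξ₀‖ = 1) :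
    ∀ᶠ ξ in 𝓝 ξ₀, ξ ≠ ξ₀ → ‖fourier φ ξ‖ < 1 := by
  obtain ⟨U, Q, R, Q', R', hE, -, hR, A, -, k, -, hA, -, hR', -⟩ := h
  obtain ⟨b, hb, hbR⟩ := hR.exists_abs_le_mul hA
    (fun ε hε K hK => hR'.abs_le le_rfl (hR.contracting _ hA) hE.isOpen hE.zero_mem
      hE.smooth_R' hE.R'_zero hε hK) one_half_pos
  exact ConvPower.eventually_norm_fourier_lt_one hE hξ₀ hR hb hbR

theorem sub_mem_nhds_zero {W : Set (E d)} (hW : W ∈ 𝓝 ξ₀) : {ξ | ξ + ξ₀ ∈ W} ∈ 𝓝 (0 : E d) := by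
  have : Continuous fun ξ : E d => ξ + ξ₀ := by fun_prop
  exact this.tendsto' 0 ξ₀ (zero_add _) hW

/-- Only moduli enter: the kernel is at most exp(-(n/2)R), and
`IsPositiveHomogeneous.lintegral_exp_neg_le` applies with l = n/2. The neighbourhood is a sublevel
set of R, small enough that |R'| ≤ R/2 on it. -/
theorem HasPositiveHomogeneousType.hasLocalDecay (h : HasPositiveHomogeneousType φ ξ₀ μ)
    (hξ₀ : ‖fourier φ ξ₀‖ = 1) (x : Fin d → ℤ) : HasLocalDecay φ x ξ₀ μ := by
  obtain ⟨U, Q, R, Q', R', hE, hR, A, hA, -, hR', -, rfl⟩ := h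
  intro W hW
  obtain ⟨b₁, hb₁, hbR⟩ := hR.exists_abs_le_mul hA hR'.2 one_half_pos
  obtain ⟨b₂, hb₂, hbU'⟩ := hR.exists_sublevel_subset
    (inter_mem (hE.isOpen.mem_nhds hE.zero_mem) (sub_mem_nhds_zero hW))
  have hbU : ∀ ξ, polyFun R ξ < b₂ → ξ ∈ U ∩ {ξ | ξ + ξ₀ ∈ W} := fun ξ hξ => hbU' hξ
  obtain ⟨C, hC, hCle⟩ := hR.lintegral_exp_neg_le hA
  set b := min b₁ b₂
  have hcont : Continuous fun ξ => polyFun R (ξ - ξ₀) :=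
    hR.continuous.comp (continuous_id.sub continuous_const)
  have hN : IsOpen {ξ | polyFun R (ξ - ξ₀) < b} := isOpen_lt hcont continuous_const
  refine ⟨{ξ | polyFun R (ξ - ξ₀) < b}, fun ξ hξ => ?_, hN, ?_,
    C.toReal * (1 / 2) ^ (-tr A), fun n hn => ?_⟩
  · have := (hbU _ (lt_of_lt_of_le hξ (min_le_right _ _))).2
    simpa using this
  · rw [mem_ofPred_eq, sub_self, hR.map_zero]
    exact lt_min hb₁ hb₂
  have hn0 : (0 : ℝ) < n := by exact_mod_cast hn
  have hpt : ∀ ξ ∈ {ξ | polyFun R (ξ - ξ₀) < b}, ‖inversionKernel φ n x ξ‖ ≤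
      Real.exp (-((n / 2 : ℝ) * polyFun R (ξ - ξ₀))) := fun ξ hξ => by
    have h1 := hE.norm_fourier_eq hξ₀ (hbU _ (lt_of_lt_of_le hξ (min_le_right _ _))).1
    rw [sub_add_cancel] at h1
    rw [norm_inversionKernel, h1, ← Real.exp_nat_mul, Real.exp_le_exp]
    have h2 : -R' (ξ - ξ₀) ≤ 1 / 2 * polyFun R (ξ - ξ₀) := by
      by_cases h0 : ξ - ξ₀ = 0
      · rw [h0, hE.R'_zero, hR.map_zero]; simp
      · linarith [(abs_le.1 (hbR _ h0 (lt_of_lt_of_le hξ (min_le_left _ _)))).1]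
    nlinarith
  have hlin : ∫⁻ ξ in {ξ | polyFun R (ξ - ξ₀) < b},
      ENNReal.ofReal ‖inversionKernel φ n x ξ‖ ≤
      C * ENNReal.ofReal ((n / 2 : ℝ) ^ (-tr A)) :=
    calc _ ≤ ∫⁻ ξ in {ξ | polyFun R (ξ - ξ₀) < b},
          ENNReal.ofReal (Real.exp (-((n / 2 : ℝ) * polyFun R (ξ - ξ₀)))) :=
          setLIntegral_mono' hN.measurableSet fun ξ hξ => ENNReal.ofReal_le_ofReal (hpt ξ hξ)
      _ ≤ ∫⁻ ξ, ENNReal.ofReal (Real.exp (-((n / 2 : ℝ) * polyFun R (ξ - ξ₀)))) :=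
          setLIntegral_le_lintegral _ _
      _ = ∫⁻ ξ, ENNReal.ofReal (Real.exp (-((n / 2 : ℝ) * polyFun R ξ))) :=
          lintegral_sub_right_eq_self
            (fun ξ => ENNReal.ofReal (Real.exp (-((n / 2 : ℝ) * polyFun R ξ)))) ξ₀
      _ ≤ _ := hCle _ (by positivity)
  have hfin : C * ENNReal.ofReal ((n / 2 : ℝ) ^ (-tr A)) ≠ ⊤ :=
    ENNReal.mul_ne_top hC ENNReal.ofReal_ne_top
  refine (norm_integral_le_lintegral_norm _).trans ((ENNReal.toReal_mono hfin hlin).trans ?_)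
  rw [ENNReal.toReal_mul, ENNReal.toReal_ofReal (by positivity), div_eq_mul_one_div,
    Real.mul_rpow hn0.le (by norm_num)]
  apply le_of_eq
  ring

/-- When Q(y) ≠ 0, the functions Q(t^A y) and tQ(y) are continuous on the connected set (0, ∞) and
have equal squares, and the second never vanishes. They therefore differ by one global sign, which t
= 1 shows to be +. Thus the sign of Q is constant along orbits and the phase is linear in t. -/
theorem IsHomogeneousWrt.of_abs {Q : E d → ℝ} (hQ : Continuous Q)
    (hA : IsHomogeneousWrt (fun ξ => |Q ξ|) A) : IsHomogeneousWrt Q A := by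
  intro r hr y
  by_cases hy : Q y = 0
  · have : r * |Q y| = |Q (opPow r A y)| := hA r hr y
    rw [hy, abs_zero, mul_zero] at this
    rw [hy, mul_zero]
    exact (abs_eq_zero.1 this.symm).symm
  have hcont : ContinuousOn (fun t => Q (opPow t A y)) (Ioi 0) :=
    hQ.comp_continuousOn ((continuousOn_opPow_apply A).comp (f := fun r => (r, y))
      (by fun_prop) fun t ht => ⟨ht, mem_univ _⟩)
  have hcont2 : ContinuousOn (fun t => t * Q y) (Ioi (0 : ℝ)) := by fun_prop
  have hsq : EqOn ((fun t => Q (opPow t A y)) ^ 2) ((fun t => t * Q y) ^ 2) (Ioi 0) := by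
    intro t ht
    have : t * |Q y| = |Q (opPow t A y)| := hA t ht y
    simp only [Pi.pow_apply]
    rw [← sq_abs, ← this, mul_pow, sq_abs, mul_pow]
  rcases isPreconnected_Ioi.eq_or_eq_neg_of_sq_eq hcont hcont2 hsq
    (fun ht => mul_ne_zero (ne_of_gt ht) hy) with h | h
  · exact (h hr).symm
  · exfalso
    have h1 : Q (opPow 1 A y) = -(1 * Q y) := h (mem_Ioi.2 one_pos)
    rw [opPow_one, one_mul] at h1
    have h2 : Q y = -Q y := h1
    exact hy (by linarith)

end Local

/-! ### Points of imaginary homogeneous type. -/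

section Imaginary

variable {d : ℕ} {P : E d → ℝ} {A : End d} {φ : (Fin d → ℤ) → ℂ} {ξ₀ : E d} {μ : ℝ}

theorem mul_exp_neg_mul_le {c y : ℝ} (hc : 0 < c) : y * Real.exp (-(c * y)) ≤ 1 / c := by
  rw [Real.exp_neg, ← div_eq_mul_inv, div_le_div_iff₀ (Real.exp_pos _) hc]
  linarith [Real.add_one_le_exp (c * y)]

theorem hasDerivAt_rpow_mul_cexp {μ t : ℝ} (ht : 0 < t) {z : ℝ → ℂ} {z' : ℂ}
    (hz : HasDerivAt z z' t) :
    HasDerivAt (fun t : ℝ => ((t ^ (μ - 1) : ℝ) : ℂ) * Complex.exp (z t))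
      ((((μ - 1) * t ^ (μ - 2) : ℝ) : ℂ) * Complex.exp (z t) +
        ((t ^ (μ - 1) : ℝ) : ℂ) * (Complex.exp (z t) * z')) t := by
  have h1 := (Real.hasDerivAt_rpow_const (p := μ - 1) (Or.inl ht.ne')).ofReal_comp
  rw [show μ - 1 - 1 = μ - 2 by ring] at h1
  exact h1.mul hz.cexp

/-- Damping exponent `-n ρ(t) - i β(t)` with `ρ(t) = t ^ k c + w(t ^ k)`: the amplitude
`t ^ (μ - 1) exp (-n ρ(t) - i β(t))` obeys bounds that are uniform in `n`. -/
theorem exists_hasDerivAt_amplitude {μ k m M L B : ℝ} (hμ : μ < 1) (hk : 1 < k) (hm : 0 < m)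
    (hL : 0 ≤ L) (n : ℝ) (hn : 0 ≤ n) {c : ℝ} (hmc : m ≤ c) (hcM : c ≤ M) {w β β' : ℝ → ℝ}
    (hw : ∀ t ∈ Ioo 0 B, DifferentiableAt ℝ w (t ^ k))
    (hw0 : ∀ t ∈ Ioo 0 B, |w (t ^ k)| ≤ m / 2 * t ^ k)
    (hw1 : ∀ t ∈ Ioo 0 B, |deriv w (t ^ k)| ≤ m / 2)
    (hβ : ∀ t ∈ Ioo 0 B, HasDerivAt β (β' t) t) (hβL : ∀ t ∈ Ioo 0 B, |β' t| ≤ L / t) :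
    ∃ g' : ℝ → ℂ, ∀ t ∈ Ioo 0 B,
      HasDerivAt (fun t : ℝ => ((t ^ (μ - 1) : ℝ) : ℂ) *
        Complex.exp (((-(n * (t ^ k * c + w (t ^ k))) : ℝ) : ℂ) - Complex.I * (β t : ℂ))) (g' t) t ∧
      ‖((t ^ (μ - 1) : ℝ) : ℂ) *
        Complex.exp (((-(n * (t ^ k * c + w (t ^ k))) : ℝ) : ℂ) - Complex.I * (β t : ℂ))‖ ≤
          (2 + k * (M + m / 2) * (2 / m) + L - μ) * t ^ (μ - 1) ∧
      ‖g' t‖ ≤ (2 + k * (M + m / 2) * (2 / m) + L - μ) * t ^ (μ - 2) := by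
  -- The derivative needs 1 - μ for the power of t, the product for the damping and `L` for β. The
  -- extra 1 guarantees D ≥ 1, which the bound on the amplitude itself uses.
  set D := 2 + k * (M + m / 2) * (2 / m) + L - μ with hD
  have hM : 0 < M := hm.trans_le (hmc.trans hcM)
  have hk0 : 0 < k := by linarith
  have hD1 : 1 ≤ D := by
    have : 0 ≤ k * (M + m / 2) * (2 / m) := by positivity
    linarith
  set z : ℝ → ℂ := fun t => ((-(n * (t ^ k * c + w (t ^ k))) : ℝ) : ℂ) - Complex.I * (β t : ℂ)
  have hpow : ∀ t ∈ Ioo 0 B, HasDerivAt (fun t : ℝ => t ^ k) (k * t ^ (k - 1)) t := fun t ht =>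
    Real.hasDerivAt_rpow_const (Or.inl ht.1.ne')
  have hz : ∀ t ∈ Ioo 0 B, HasDerivAt z (((-(n * (k * t ^ (k - 1) * c +
      deriv w (t ^ k) * (k * t ^ (k - 1)))) : ℝ) : ℂ) - Complex.I * (β' t : ℂ)) t := fun t ht => by
    have h1 : HasDerivAt (fun t => w (t ^ k)) (deriv w (t ^ k) * (k * t ^ (k - 1))) t :=
      (hw t ht).hasDerivAt.comp t (hpow t ht)
    have h2 := ((((hpow t ht).mul_const c).add h1).const_mul n).neg.ofReal_comp
    exact h2.sub ((hβ t ht).ofReal_comp.const_mul Complex.I)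
  have hze : ∀ t ∈ Ioo 0 B, ‖Complex.exp (z t)‖ ≤ Real.exp (-((m / 2) * (n * t ^ k))) := by
    intro t ht
    rw [Complex.norm_exp, Real.exp_le_exp]
    have hre : (z t).re = -(n * (t ^ k * c + w (t ^ k))) := by
      simp only [z, Complex.sub_re, Complex.ofReal_re, Complex.mul_re, Complex.I_re, Complex.I_im,
        Complex.ofReal_im]
      ring
    rw [hre]
    have h1 := (abs_le.1 (hw0 t ht)).1
    have h2 : t ^ k * m ≤ t ^ k * c := mul_le_mul_of_nonneg_left hmc (Real.rpow_nonneg ht.1.le _)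
    nlinarith
  have hze1 : ∀ t ∈ Ioo 0 B, ‖Complex.exp (z t)‖ ≤ 1 := fun t ht =>
    (hze t ht).trans (Real.exp_le_one_iff.2 (by
      have := Real.rpow_nonneg ht.1.le k
      have : 0 ≤ m / 2 * (n * t ^ k) := by positivity
      linarith))
  refine ⟨_, fun t ht => ⟨hasDerivAt_rpow_mul_cexp ht.1 (hz t ht), ?_, ?_⟩⟩
  · rw [norm_mul, Complex.norm_real, Real.norm_of_nonneg (Real.rpow_nonneg ht.1.le _), mul_comm]
    exact mul_le_mul_of_nonneg_right ((hze1 t ht).trans hD1) (Real.rpow_nonneg ht.1.le _)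
  have ht0 : 0 < t := ht.1
  have e1 : t ^ (μ - 1) / t = t ^ (μ - 2) := by
    rw [← Real.rpow_sub_one ht0.ne']; congr 1; ring
  have e2 : t ^ (k - 1) = t ^ k / t := Real.rpow_sub_one ht0.ne' k
  have hz' : ‖Complex.exp (z t)‖ * ‖((-(n * (k * t ^ (k - 1) * c +
      deriv w (t ^ k) * (k * t ^ (k - 1)))) : ℝ) : ℂ) - Complex.I * (β' t : ℂ)‖ ≤
      (k * (M + m / 2) * (2 / m) + L) / t := by
    have hn1 : ‖((-(n * (k * t ^ (k - 1) * c + deriv w (t ^ k) * (k * t ^ (k - 1)))) : ℝ) : ℂ)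
        - Complex.I * (β' t : ℂ)‖ ≤ n * t ^ k * (k * (M + m / 2)) / t + L / t := by
      refine (norm_sub_le _ _).trans (add_le_add ?_ ?_)
      · rw [Complex.norm_real, norm_neg, e2,
          show n * (k * (t ^ k / t) * c + deriv w (t ^ k) * (k * (t ^ k / t))) =
            n * t ^ k * k / t * (c + deriv w (t ^ k)) by ring, norm_mul,
          Real.norm_of_nonneg (by positivity), Real.norm_eq_abs]
        have : |c + deriv w (t ^ k)| ≤ M + m / 2 := by
          refine (abs_add_le _ _).trans (add_le_add ?_ (hw1 t ht))
          rw [abs_of_pos (hm.trans_le hmc)]; exact hcM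
        calc _ ≤ n * t ^ k * k / t * (M + m / 2) := by gcongr
          _ = _ := by ring
      · rw [norm_mul, Complex.norm_I, one_mul, Complex.norm_real]
        exact hβL t ht
    -- Differentiating the damping produces a factor n t^k; the damping itself absorbs it, which
    -- makes the bound uniform in n.
    have hn2 : (n * t ^ k) * ‖Complex.exp (z t)‖ ≤ 2 / m := by
      calc _ ≤ (n * t ^ k) * Real.exp (-((m / 2) * (n * t ^ k))) := by
            gcongr
            exact hze t ht
        _ ≤ 1 / (m / 2) := mul_exp_neg_mul_le (half_pos hm)
        _ = 2 / m := by field_simp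
    calc _ ≤ ‖Complex.exp (z t)‖ * (n * t ^ k * (k * (M + m / 2)) / t + L / t) := by gcongr
      _ = (n * t ^ k * ‖Complex.exp (z t)‖) * (k * (M + m / 2)) / t +
          ‖Complex.exp (z t)‖ * (L / t) := by ring
      _ ≤ (2 / m) * (k * (M + m / 2)) / t + 1 * (L / t) := by
          gcongr
          exact hze1 t ht
      _ = _ := by ring
  refine (norm_add_le _ _).trans ?_
  rw [norm_mul, norm_mul _ (_ * _), norm_mul (Complex.exp _), Complex.norm_real, Complex.norm_real,
    Real.norm_eq_abs, abs_mul, Real.norm_of_nonneg (Real.rpow_nonneg ht0.le (μ - 1)),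
    abs_of_nonneg (Real.rpow_nonneg ht0.le (μ - 2)), abs_of_neg (by linarith : μ - 1 < 0)]
  have hμ0 : 0 < -(μ - 1) := by linarith
  calc _ ≤ -(μ - 1) * t ^ (μ - 2) * 1 +
        t ^ (μ - 1) * ((k * (M + m / 2) * (2 / m) + L) / t) := by
        gcongr
        exact hze1 t ht
    _ = -(μ - 1) * t ^ (μ - 2) + (k * (M + m / 2) * (2 / m) + L) * (t ^ (μ - 1) / t) := by ring
    _ = (1 + k * (M + m / 2) * (2 / m) + L - μ) * t ^ (μ - 2) := by rw [e1]; ring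
    _ ≤ _ := by
        gcongr
        linarith

/-- On the orbit of y the kernel is a unimodular constant times e^{-in(σt + q(t))} times the damping
and the character of x. The last two go into the amplitude and the first is the oscillation.
Compactness of the closed shell 1 ≤ |Q| ≤ 2 makes all constants uniform in y. -/
theorem exists_orbit_integral_bound {U : Set (E d)} {Q R : MvPolynomial (Fin d) ℝ}
    {Q' R' : E d → ℝ} (hE : IsExpansion φ ξ₀ U Q R Q' R') (hξ₀ : ‖fourier φ ξ₀‖ = 1)
    (hdrift : drift φ ξ₀ = 0)
    (hQ : IsPositiveHomogeneous fun ξ => |polyFun Q ξ|) (hR : IsPositiveHomogeneous (polyFun R))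
    (hA : A ∈ expSet fun ξ => |polyFun Q ξ|) {k : ℝ} (hk : 1 < k)
    (hRA : IsHomogeneousWrt (polyFun R) (k⁻¹ • A)) (hQ' : IsStronglySubhomogeneous 2 U Q' A)
    (hR' : IsStronglySubhomogeneous 1 U R' (k⁻¹ • A)) (hQc : Continuous (polyFun Q))
    (hμ : μ < 1) (x : Fin d → ℤ) :
    ∃ B : ℝ, 0 < B ∧ ∃ C : ℝ, 0 ≤ C ∧ ∀ n : ℕ, 1 ≤ n → ∀ a b : ℝ, 0 < a → a ≤ b → b < B →
      ∀ y, 1 ≤ |polyFun Q y| → |polyFun Q y| < 2 →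
      ‖∫ t in a..b, ((t ^ (μ - 1) : ℝ) : ℂ) * inversionKernel φ n x (opPow t A y + ξ₀)‖ ≤
        C / n * a ^ (μ - 1) := by
  have hk0 : 0 < k := by linarith
  have hS : IsCompact {y | 1 ≤ |polyFun Q y| ∧ |polyFun Q y| ≤ 2} :=
    (hQ.isCompact_sublevel 2).of_isClosed_subset
      ((isClosed_le continuous_const hQ.continuous).inter
        (isClosed_le hQ.continuous continuous_const)) fun y hy => hy.2
  set S := {y | 1 ≤ |polyFun Q y| ∧ |polyFun Q y| ≤ 2}
  obtain ⟨m, hm, hmS⟩ := hS.exists_forall_le' hR.continuous.continuousOn (a := 0) fun y hy =>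
    hR.posDef.pos (by
      rintro rfl
      have h1 := hy.1
      have h2 : |polyFun Q 0| = 0 := hQ.map_zero
      rw [h2] at h1
      exact absurd h1 (by norm_num))
  obtain ⟨M, hM⟩ := hS.bddAbove_image hR.continuous.continuousOn
  have hMS : ∀ y ∈ S, polyFun R y ≤ M := fun y hy => hM (mem_image_of_mem _ hy)
  obtain ⟨δ₁, hδ₁, h1⟩ := (hQ.contracting A hA).eventually_mem hS
    (inter_mem (hE.isOpen.mem_nhds hE.zero_mem) (Metric.ball_mem_nhds 0 one_pos))
  obtain ⟨δ₂, hδ₂, h2⟩ := hQ'.abs_deriv_le (by norm_num) one_half_pos hS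
  obtain ⟨δ₃, hδ₃, h3⟩ := hQ'.2 (1 / 2) one_half_pos S hS
  obtain ⟨δ₄, hδ₄, h4⟩ := hR'.abs_deriv_le le_rfl (half_pos hm) hS
  obtain ⟨δ₅, hδ₅, h5⟩ := hR'.abs_le le_rfl (hR.contracting _ hRA) hE.isOpen hE.zero_mem
    hE.smooth_R' hE.R'_zero (half_pos hm) hS
  set δ := min δ₄ δ₅ with hδ
  have hδpos : 0 < δ := lt_min hδ₄ hδ₅
  -- The bounds on `R'` are in the variable t^k, so their threshold δ becomes δ^{1/k} for t.
  set B := min (min δ₁ δ₂) (min δ₃ (δ ^ k⁻¹)) with hB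
  have hBpos : 0 < B :=
    lt_min (lt_min hδ₁ hδ₂) (lt_min hδ₃ (Real.rpow_pos_of_pos hδpos _))
  set L := ‖latticePt x‖ * ‖A‖ with hL
  set D := 2 + k * (M + m / 2) * (2 / m) + L - μ with hD
  refine ⟨B, hBpos, 2 * |D| * (2 + (1 + 1) / (1 - μ)), ?_, ?_⟩
  · have : 0 < 1 - μ := by linarith
    positivity
  intro n hn a b ha hab hbB y hy1 hy2
  have hyS : y ∈ S := ⟨hy1, hy2.le⟩
  have hn0 : (0 : ℝ) < n := by exact_mod_cast hn
  have hBt : ∀ t ∈ Ioo 0 B, t < δ₁ ∧ t < δ₂ ∧ t < δ₃ ∧ t ^ k < δ₄ ∧ t ^ k < δ₅ := by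
    intro t ht
    have hb := ht.2
    rw [hB, lt_min_iff, lt_min_iff, lt_min_iff] at hb
    have htk : t ^ k < δ := by
      have := Real.rpow_lt_rpow ht.1.le hb.2.2 hk0
      rwa [← Real.rpow_mul hδpos.le, inv_mul_cancel₀ hk0.ne', Real.rpow_one] at this
    exact ⟨hb.1.1, hb.1.2, hb.2.1, htk.trans_le (min_le_left _ _), htk.trans_le (min_le_right _ _)⟩
  have hmem : ∀ t ∈ Ioo 0 B, opPow t A y ∈ U := fun t ht => (h1 t ht.1 (hBt t ht).1 y hyS).1
  set q : ℝ → ℝ := fun t => Q' (opPow t A y) with hq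
  set w : ℝ → ℝ := fun s => R' (opPow s (k⁻¹ • A) y) with hw
  set σ := polyFun Q y with hσ
  have hqs : ∀ t ∈ Ioo 0 B, ContDiffAt ℝ ∞ q t := fun t ht =>
    contDiffAt_comp_opPow hE.isOpen hE.smooth_Q' A ht.1 (hmem t ht)
  have hpow : ∀ t, 0 < t → opPow (t ^ k) (k⁻¹ • A) y = opPow t A y := fun t ht => by
    rw [opPow_rpow_inv_smul ht hk0.ne']
  have hwd : ∀ t ∈ Ioo 0 B, DifferentiableAt ℝ w (t ^ k) := fun t ht =>
    (contDiffAt_comp_opPow hE.isOpen hE.smooth_R' (k⁻¹ • A) (Real.rpow_pos_of_pos ht.1 k)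
      (by rw [hpow t ht.1]; exact hmem t ht)).differentiableAt (by simp)
  have hβ : ∀ t ∈ Ioo 0 B, HasDerivAt (fun t => inner ℝ (latticePt x) (opPow t A y))
      (inner ℝ (latticePt x) (t⁻¹ • A (opPow t A y))) t := fun t ht => by
    have := (hasDerivAt_const t (latticePt x)).inner ℝ (hasDerivAt_opPow_apply ht.1 A y)
    simpa using this
  have hβL : ∀ t ∈ Ioo 0 B, |inner ℝ (latticePt x) (t⁻¹ • A (opPow t A y))| ≤ L / t := by
    intro t ht
    have ht0 : 0 < t := ht.1
    refine (abs_real_inner_le_norm _ _).trans ?_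
    rw [norm_smul, Real.norm_of_nonneg (inv_nonneg.2 ht.1.le)]
    have hb : ‖opPow t A y‖ ≤ 1 := by
      have := (h1 t ht.1 (hBt t ht).1 y hyS).2
      rw [mem_ball_zero_iff] at this
      exact this.le
    calc _ ≤ ‖latticePt x‖ * (t⁻¹ * (‖A‖ * 1)) := by
          gcongr
          exact (A.le_opNorm _).trans (by gcongr)
      _ = L / t := by rw [hL]; ring
  obtain ⟨g', hg'⟩ := exists_hasDerivAt_amplitude (μ := μ) hμ hk hm (by positivity : 0 ≤ L) n
    hn0.le (hmS y hyS) (hMS y hyS) hwd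
    (fun t ht => h5 (t ^ k) (Real.rpow_pos_of_pos ht.1 k) (hBt t ht).2.2.2.2 y hyS)
    (fun t ht => h4 (t ^ k) (Real.rpow_pos_of_pos ht.1 k) (hBt t ht).2.2.2.1 y hyS) hβ hβL
  set g : ℝ → ℂ := fun t => ((t ^ (μ - 1) : ℝ) : ℂ) *
    Complex.exp (((-(n * (t ^ k * polyFun R y + w (t ^ k))) : ℝ) : ℂ) -
      Complex.I * ((inner ℝ (latticePt x) (opPow t A y) : ℝ) : ℂ)) with hg
  have hD0 : 0 ≤ |D| := abs_nonneg D
  have hσq : ∀ t ∈ Ioo 0 B, 1 / 2 ≤ |σ + deriv q t| := fun t ht => by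
    have e1 := h2 t ht.1 (hBt t ht).2.1 y hyS
    have e2 : |σ| ≤ |σ + deriv q t| + |deriv q t| := by
      simpa using abs_sub (σ + deriv q t) (deriv q t)
    linarith
  -- From |σ| ≥ 1 and |q'| ≤ 1/2 one gets |θ'| ≥ n/2, and t|q''| ≤ 1/2 gives |θ''| ≤ (n/2)/t. Hence
  -- l = n/2 and M = 1.
  have hvdc := norm_integral_exp_I_mul_le (l := n / 2) (M := 1) (D := |D|) ha hab hbB hμ
    (by positivity) zero_le_one hD0
    (θ := fun t => -(n * (σ * t + q t))) (θ' := fun t => -(n * (σ + deriv q t)))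
    (θ'' := fun t => -(n * iteratedDeriv 2 q t)) (g := g) (g' := g')
    (fun t ht => by
      have e1 : HasDerivAt q (deriv q t) t :=
        ((hqs t ht).differentiableAt (by simp)).hasDerivAt
      have e2 := ((((hasDerivAt_id t).const_mul σ).add e1).const_mul (n : ℝ)).neg
      rw [mul_one] at e2
      exact e2)
    (fun t ht => by
      have e1 : HasDerivAt (deriv q) (iteratedDeriv 2 q t) t := by
        rw [iteratedDeriv_succ, iteratedDeriv_one]
        have h : ContDiffAt ℝ 1 (deriv q) t :=
          ((hqs t ht).of_le (m := 2) ENat.LEInfty.out).derivWithin (by norm_num)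
        exact (h.differentiableAt (by simp)).hasDerivAt
      exact ((e1.const_add σ).const_mul (n : ℝ)).neg)
    (fun t ht => (hg' t ht).1)
    (fun t ht => by
      rw [abs_neg, abs_mul, abs_of_pos hn0]
      have := hσq t ht
      nlinarith)
    (fun t ht => by
      have ht0 : 0 < t := ht.1
      have e1 := h3 2 (by norm_num) le_rfl t ht.1 (hBt t ht).2.2.1 y hyS
      rw [abs_mul, abs_of_pos (by positivity)] at e1
      rw [abs_neg, abs_mul, abs_of_pos hn0, one_mul, le_div_iff₀ ht0]
      have e3 : t * |iteratedDeriv 2 q t| ≤ 1 / 2 := by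
        refine le_of_mul_le_mul_left ?_ ht0
        calc t * (t * |iteratedDeriv 2 q t|) = t ^ 2 * |iteratedDeriv 2 q t| := by ring
          _ ≤ 1 / 2 * t := e1
          _ = _ := by ring
      nlinarith)
    (fun t ht => (hg' t ht).2.1.trans
      (mul_le_mul_of_nonneg_right (le_abs_self D) (Real.rpow_nonneg ht.1.le _)))
    (fun t ht => (hg' t ht).2.2.trans
      (mul_le_mul_of_nonneg_right (le_abs_self D) (Real.rpow_nonneg ht.1.le _)))
  set c := fourier φ ξ₀ ^ n *
    Complex.exp (-(Complex.I * ((inner ℝ (latticePt x) ξ₀ : ℝ) : ℂ))) with hc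
  have hc1 : ‖c‖ = 1 := by
    rw [hc, norm_mul, norm_exp_neg_I_mul, norm_pow, hξ₀, one_pow, one_mul]
  have hcongr : ∀ t ∈ Ioo 0 B,
      ((t ^ (μ - 1) : ℝ) : ℂ) * inversionKernel φ n x (opPow t A y + ξ₀) =
        c * (Complex.exp (Complex.I * ((-(n * (σ * t + q t)) : ℝ) : ℂ)) * g t) := fun t ht => by
    have eQ : polyFun Q (opPow t A y) = σ * t := by
      rw [(IsHomogeneousWrt.of_abs hQc hA).apply_opPow ht.1, mul_comm]
    have eR : polyFun R (opPow t A y) = t ^ k * polyFun R y := by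
      rw [← hpow t ht.1, hRA.apply_opPow (Real.rpow_pos_of_pos ht.1 k)]
    have eR' : R' (opPow t A y) = w (t ^ k) := by
      simp only [hw, hpow t ht.1]
    rw [inversionKernel, hE.fourier_eq hξ₀ (hmem t ht), hdrift, inner_zero_left, mul_pow,
      ← Complex.exp_nat_mul, eQ, eR, eR', inner_add_right]
    simp only [hc, hg, hq]
    have e : ∀ u v z1 z2 z3 z4 z5 : ℂ, Complex.exp z1 * Complex.exp z2 =
        Complex.exp z3 * (Complex.exp z4 * Complex.exp z5) →
        u * (v * Complex.exp z1 * Complex.exp z2) =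
          v * Complex.exp z3 * (Complex.exp z4 * (u * Complex.exp z5)) := by
      intro u v z1 z2 z3 z4 z5 h
      linear_combination (u * v) * h
    apply e
    rw [← Complex.exp_add, ← Complex.exp_add, ← Complex.exp_add]
    congr 1
    push_cast
    ring
  have hint : ∫ t in a..b, ((t ^ (μ - 1) : ℝ) : ℂ) * inversionKernel φ n x (opPow t A y + ξ₀) =
      c * ∫ t in a..b, Complex.exp (Complex.I * ((-(n * (σ * t + q t)) : ℝ) : ℂ)) * g t := by
    rw [← intervalIntegral.integral_const_mul]
    refine intervalIntegral.integral_congr fun t ht => ?_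
    rw [uIcc_of_le hab] at ht
    exact hcongr t ⟨ha.trans_le ht.1, ht.2.trans_lt hbB⟩
  rw [hint, norm_mul, hc1, one_mul]
  refine hvdc.trans (le_of_eq ?_)
  field_simp

/-- The sublevel set {|Q| < b} is cut at |Q| = 1/n, where the phase nQ starts to oscillate. The
inner part is bounded by its volume, the outer one by the orbit estimate; both are of order n^{-tr
A}. -/
theorem HasImaginaryHomogeneousType.hasLocalDecay (h : HasImaginaryHomogeneousType φ ξ₀ μ)
    (hξ₀ : ‖fourier φ ξ₀‖ = 1) (hc : Continuous (fourier φ)) (hle : ∀ ξ, ‖fourier φ ξ‖ ≤ 1)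
    (hdrift : drift φ ξ₀ = 0) (hμ : μ < 1) (x : Fin d → ℤ) : HasLocalDecay φ x ξ₀ μ := by
  obtain ⟨U, Q, R, Q', R', hE, hQ, hR, A, hA, k, hk, hRA, hQ', hR', rfl⟩ := h
  intro W hW
  have hQc : Continuous (polyFun Q) := by
    have : Continuous fun ξ : E d => (fun i => ξ i) := by fun_prop
    exact (MvPolynomial.continuous_eval Q).comp this
  obtain ⟨B, hB, C, hC, hbound⟩ := exists_orbit_integral_bound hE hξ₀ hdrift hQ hR hA hk hRA hQ' hR'
    hQc hμ x
  obtain ⟨b₂, hb₂, hbW⟩ := hQ.exists_sublevel_subset (sub_mem_nhds_zero hW)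
  set P : E d → ℝ := fun ξ => |polyFun Q ξ| with hP
  set b := min (B / 2) b₂ with hb
  have hb0 : 0 < b := lt_min (half_pos hB) hb₂
  have hbB : b < B := (min_le_left _ _).trans_lt (half_lt_self hB)
  have hcont : Continuous fun ξ => P (ξ - ξ₀) :=
    hQ.continuous.comp (continuous_id.sub continuous_const)
  have hN : IsOpen {ξ | P (ξ - ξ₀) < b} := isOpen_lt hcont continuous_const
  set V := volume.real {y | P y ≤ 1} with hV
  set V₂ := volume.real {y | 1 ≤ P y ∧ P y < 2} with hV₂
  refine ⟨{ξ | P (ξ - ξ₀) < b}, fun ξ hξ => ?_, hN, ?_,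
    V + C * 2 ^ (1 - tr A) * V₂ / Real.log 2, fun n hn => ?_⟩
  · have : ξ - ξ₀ ∈ {ξ | ξ + ξ₀ ∈ W} := hbW (lt_of_lt_of_le (b := b) hξ (min_le_right _ _))
    simpa using this
  · rw [mem_ofPred_eq, sub_self, hQ.map_zero]
    exact hb0
  have hn0 : (0 : ℝ) < n := by exact_mod_cast hn
  set f : E d → ℂ := fun ξ => inversionKernel φ n x (ξ + ξ₀) with hf
  have hfc : Continuous f := (continuous_inversionKernel hc n x).comp
    (continuous_id.add continuous_const)
  have hf1 : ∀ ξ, ‖f ξ‖ ≤ 1 := fun ξ => by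
    rw [hf, norm_inversionKernel]
    exact pow_le_one₀ (norm_nonneg _) (hle _)
  have hshift : ∫ ξ in {ξ | P (ξ - ξ₀) < b}, inversionKernel φ n x ξ = ∫ ξ in {ξ | P ξ < b}, f ξ := by
    rw [← integral_indicator hN.measurableSet,
      ← integral_indicator (isOpen_lt hQ.continuous continuous_const).measurableSet,
      ← integral_add_right_eq_self _ ξ₀]
    congr 1
    ext ξ
    by_cases hξ : P ξ < b
    · rw [indicator_of_mem (s := {ξ | P ξ < b}) hξ, indicator_of_mem]
      simpa using hξ
    · rw [indicator_of_notMem (s := {ξ | P ξ < b}) hξ, indicator_of_notMem]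
      simpa using hξ
  -- For small n the cut 1/n may exceed b; the minimum then leaves an empty annulus.
  set a := min (1 / (n : ℝ)) b with ha
  have ha0 : 0 < a := lt_min (by positivity) hb0
  have hab : a ≤ b := min_le_right _ _
  have hunion : {ξ | P ξ < b} = {ξ | P ξ < a} ∪ {ξ | a ≤ P ξ ∧ P ξ < b} := by
    ext ξ
    simp only [mem_ofPred_eq, mem_union]
    constructor
    · intro h
      rcases lt_or_ge (P ξ) a with h' | h'
      exacts [Or.inl h', Or.inr ⟨h', h⟩]
    · rintro (h | h)
      exacts [h.trans_le hab, h.2]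
  have hfin : ∀ t, volume {ξ | P ξ ≤ t} < ⊤ := fun t => (hQ.isCompact_sublevel t).measure_lt_top
  have hfint : ∀ s ⊆ {ξ | P ξ ≤ b}, IntegrableOn f s := fun s hs =>
    (hfc.continuousOn.integrableOn_compact (hQ.isCompact_sublevel b)).mono_set hs
  have hmeas2 : MeasurableSet {ξ | a ≤ P ξ ∧ P ξ < b} :=
    (isClosed_le continuous_const hQ.continuous).measurableSet.inter
      (isOpen_lt hQ.continuous continuous_const).measurableSet
  rw [hshift, hunion, setIntegral_union ?_ hmeas2 (hfint {ξ | P ξ < a} fun ξ hξ => (le_of_lt hξ).trans hab)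
    (hfint _ fun ξ hξ => hξ.2.le)]
  swap
  · exact disjoint_left.2 fun ξ h1 h2 => not_le.2 h1 h2.1
  refine (norm_add_le _ _).trans ?_
  rw [add_mul]
  refine add_le_add ?_ ?_
  · have hsub : {ξ | P ξ < a} ⊆ {ξ | P ξ ≤ 1 / (n : ℝ)} := fun ξ hξ =>
      (le_of_lt (show P ξ < a from hξ)).trans (min_le_left _ _)
    refine (norm_setIntegral_le_of_norm_le_const ((measure_mono hsub).trans_lt (hfin _))
      fun ξ _ => hf1 ξ).trans ?_
    rw [one_mul]
    refine (measureReal_mono hsub (hfin _).ne).trans (le_of_eq ?_)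
    rw [measureReal_def, IsHomogeneousWrt.volume_sublevel hA (by positivity), ENNReal.toReal_mul,
      ENNReal.toReal_ofReal (by positivity), one_div, Real.inv_rpow hn0.le, ← Real.rpow_neg hn0.le,
      hV, measureReal_def, mul_comm]
  · have hlog : 0 < Real.log 2 := Real.log_pos one_lt_two
    rcases le_or_gt b (1 / (n : ℝ)) with hbn | hbn
    · have : {ξ | a ≤ P ξ ∧ P ξ < b} = ∅ := by
        rw [ha, min_eq_right hbn]
        ext ξ
        simp only [mem_ofPred_eq, mem_empty_iff_false, iff_false, not_and, not_lt]
        exact id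
      rw [this, setIntegral_empty, norm_zero]
      positivity
    have han : a = 1 / n := min_eq_left hbn.le
    have h2 := hQ.norm_setIntegral_annulus_le hA hfc hf1 (M := C * 2 ^ (1 - tr A) * (n : ℝ) ^ (-tr A))
      ha0 hab fun y hy1 hy2 => by
        have hy0 : 0 < P y := one_pos.trans_le hy1
        refine (hbound n hn (a / P y) (b / P y) (by positivity) (by gcongr)
          ((div_le_self hb0.le hy1).trans_lt hbB) y hy1 hy2).trans ?_
        -- On the shell P(y) < 2, so a/P(y) ≥ 1/(2n); the exponent is negative. This is the source
        -- of 2^{1 - tr A}.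
        have h1 : (a / P y) ^ (tr A - 1) ≤ (1 / (2 * n) : ℝ) ^ (tr A - 1) := by
          refine Real.rpow_le_rpow_of_nonpos (by positivity) ?_ (by linarith)
          rw [han, div_div, mul_comm]
          gcongr
        have h3 : (1 / (2 * n) : ℝ) ^ (tr A - 1) = 2 ^ (1 - tr A) * ((n : ℝ) ^ (-tr A) * n) := by
          rw [one_div, Real.inv_rpow (by positivity), ← Real.rpow_neg (by positivity), neg_sub,
            Real.mul_rpow two_pos.le hn0.le, ← Real.rpow_add_one hn0.ne']
          congr 2
          ring
        calc _ ≤ C / n * (1 / (2 * n) : ℝ) ^ (tr A - 1) := by gcongr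
          _ = _ := by rw [h3]; field_simp
    refine h2.trans (le_of_eq ?_)
    rw [hV₂]
    ring

end Imaginary

/-! ### Periodicity and Fourier inversion for convolution powers. -/

section Inversion

variable {d : ℕ} {φ : (Fin d → ℤ) → ℂ}

theorem MemS.summable_norm (hφ : MemS φ) : Summable fun x => ‖φ x‖ := by
  simpa using hφ 0

theorem inner_latticePt (x : Fin d → ℤ) (ξ : E d) :
    inner ℝ (latticePt x) ξ = ∑ i, (x i : ℝ) * ξ i := by
  simp [latticePt, PiLp.inner_apply, mul_comm]

theorem norm_exp_I_mul (s : ℝ) : ‖Complex.exp (Complex.I * (s : ℂ))‖ = 1 := by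
  rw [mul_comm]; exact Complex.norm_exp_ofReal_mul_I _

theorem continuous_fourier (hφ : Summable fun x => ‖φ x‖) : Continuous (fourier φ) := by
  refine continuous_tsum (u := fun x => ‖φ x‖) (fun x => by fun_prop) hφ fun x ξ => ?_
  rw [norm_mul, norm_exp_I_mul, mul_one]

theorem inner_latticePt_latticePt (x m : Fin d → ℤ) :
    inner ℝ (latticePt x) (latticePt m) = ((∑ i, x i * m i : ℤ) : ℝ) := by
  rw [inner_latticePt]
  simp [latticePt]

theorem exp_I_inner_add_latticePt (x m : Fin d → ℤ) (ξ : E d) :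
    Complex.exp (Complex.I * ((inner ℝ (latticePt x) (ξ + (2 * Real.pi) • latticePt m) : ℝ) : ℂ)) =
      Complex.exp (Complex.I * ((inner ℝ (latticePt x) ξ : ℝ) : ℂ)) := by
  rw [inner_add_right, inner_smul_right, inner_latticePt_latticePt]
  refine Complex.exp_eq_exp_iff_exists_int.2 ⟨∑ i, x i * m i, ?_⟩
  push_cast
  ring

theorem fourier_add_latticePt (φ : (Fin d → ℤ) → ℂ) (m : Fin d → ℤ) (ξ : E d) :
    fourier φ (ξ + (2 * Real.pi) • latticePt m) = fourier φ ξ := by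
  simp only [fourier, exp_I_inner_add_latticePt]

theorem inversionKernel_add_latticePt (φ : (Fin d → ℤ) → ℂ) (n : ℕ) (x m : Fin d → ℤ) (ξ : E d) :
    inversionKernel φ n x (ξ + (2 * Real.pi) • latticePt m) = inversionKernel φ n x ξ := by
  simp only [inversionKernel, fourier_add_latticePt, Complex.exp_neg, exp_I_inner_add_latticePt]

/-- The half-open cube of side `2π` centred at `a`. -/
def cube (a : Fin d → ℝ) : Set (E d) :=
  {ξ | ∀ i, ξ i ∈ Ioc (a i - Real.pi) (a i + Real.pi)}

theorem cube_eq_preimage (a : Fin d → ℝ) :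
    cube a = WithLp.ofLp ⁻¹' (univ.pi fun i => Ioc (a i - Real.pi) (a i + Real.pi)) := by
  ext ξ
  simp [cube]

theorem volume_cube_lt_top (a : Fin d → ℝ) : volume (cube a) < ⊤ := by
  rw [cube_eq_preimage, (PiLp.volume_preserving_ofLp (Fin d)).measure_preimage
    (MeasurableSet.univ_pi fun i => measurableSet_Ioc).nullMeasurableSet, Real.volume_pi_Ioc]
  exact ENNReal.prod_lt_top fun i _ => ENNReal.ofReal_lt_top

theorem isCompact_closedCube (a : Fin d → ℝ) :
    IsCompact {ξ : E d | ∀ i, ξ i ∈ Icc (a i - Real.pi) (a i + Real.pi)} := by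
  have h : IsCompact (univ.pi fun i => Icc (a i - Real.pi) (a i + Real.pi)) :=
    isCompact_univ_pi fun i => isCompact_Icc
  have := (EuclideanSpace.equiv (Fin d) ℝ).toHomeomorph.isCompact_preimage.2 h
  convert! this using 1
  ext ξ
  simp only [mem_ofPred_eq, mem_preimage, mem_univ_pi]
  rfl

theorem exists_sub_latticePt_mem_cube (a : Fin d → ℝ) (ξ : E d) :
    ∃ m : Fin d → ℤ, ξ + (2 * Real.pi) • latticePt m ∈ cube a := by
  have h : ∀ i, ∃ k : ℤ, ξ i + k • (2 * Real.pi) ∈ Ioc (a i - Real.pi) (a i + Real.pi) := fun i => by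
    obtain ⟨k, hk, -⟩ := existsUnique_add_zsmul_mem_Ioc Real.two_pi_pos (ξ i) (a i - Real.pi)
    refine ⟨k, ?_⟩
    rwa [show a i - Real.pi + 2 * Real.pi = a i + Real.pi by ring] at hk
  choose m hm using h
  refine ⟨m, fun i => ?_⟩
  have := hm i
  simpa [latticePt, mul_comm] using this

theorem integral_exp_int_mul (k : ℤ) (c : ℝ) :
    ∫ t in Ioc (c - Real.pi) (c + Real.pi), Complex.exp (-(Complex.I * ((k * t : ℝ) : ℂ))) =
      if k = 0 then (2 * Real.pi : ℂ) else 0 := by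
  rw [← intervalIntegral.integral_of_le (by linarith [Real.pi_pos])]
  split_ifs with hk
  · simp [hk]
    ring
  · have hne : -(Complex.I * (k : ℂ)) ≠ 0 :=
      neg_ne_zero.2 (mul_ne_zero Complex.I_ne_zero (by exact_mod_cast hk))
    have : ∀ t : ℝ, Complex.exp (-(Complex.I * ((k * t : ℝ) : ℂ))) =
        Complex.exp (-(Complex.I * (k : ℂ)) * t) := fun t => by
      congr 1; push_cast; ring
    simp only [this]
    rw [integral_exp_mul_complex hne, div_eq_zero_iff]
    left
    rw [sub_eq_zero]
    refine Complex.exp_eq_exp_iff_exists_int.2 ⟨-k, ?_⟩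
    push_cast
    ring

theorem setIntegral_cube_exp (a : Fin d → ℝ) (x : Fin d → ℤ) :
    ∫ ξ in cube a, Complex.exp (-(Complex.I * ((inner ℝ (latticePt x) ξ : ℝ) : ℂ))) =
      (2 * Real.pi : ℂ) ^ d * (Pi.single 0 1 : (Fin d → ℤ) → ℂ) x := by
  have hprod : ∀ ξ : E d, Complex.exp (-(Complex.I * ((inner ℝ (latticePt x) ξ : ℝ) : ℂ))) =
      (fun y : Fin d → ℝ => ∏ i, Complex.exp (-(Complex.I * ((x i * y i : ℝ) : ℂ))))
        (WithLp.ofLp ξ) := fun ξ => by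
    simp only
    rw [inner_latticePt, ← Complex.exp_sum]
    congr 1
    push_cast
    rw [Finset.mul_sum, Finset.sum_neg_distrib]
  simp only [hprod]
  rw [cube_eq_preimage, (PiLp.volume_preserving_ofLp (Fin d)).setIntegral_preimage_emb
    (MeasurableEquiv.toLp 2 (Fin d → ℝ)).symm.measurableEmbedding
    (fun y : Fin d → ℝ => ∏ i, Complex.exp (-(Complex.I * ((x i * y i : ℝ) : ℂ)))),
    volume_pi, Measure.restrict_pi_pi,
    integral_fintype_prod_eq_prod (fun i (t : ℝ) => Complex.exp (-(Complex.I * ((x i * t : ℝ) : ℂ))))]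
  simp only [integral_exp_int_mul]
  by_cases hx : x = 0
  · simp [hx]
  · obtain ⟨i, hi⟩ : ∃ i, x i ≠ 0 := by
      by_contra h
      push Not at h
      exact hx (funext h)
    rw [Finset.prod_eq_zero (Finset.mem_univ i) (if_neg hi), Pi.single_eq_of_ne hx, mul_zero]

/-- Induction on n from orthogonality of characters at n = 0. Expanding one factor φ̂ as its series
turns the kernel at x into the sum over y of φ(y) times the previous kernel at x - y, which
integrates to a convolution. Since |φ̂| ≤ 1, summability of |φ| justifies the interchange. -/
theorem setIntegral_cube_inversionKernel (hφ : Summable fun x => ‖φ x‖)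
    (hle : ∀ ξ, ‖fourier φ ξ‖ ≤ 1) (a : Fin d → ℝ) (n : ℕ) (x : Fin d → ℤ) :
    ∫ ξ in cube a, inversionKernel φ n x ξ = (2 * Real.pi : ℂ) ^ d * convPow φ n x := by
  have : IsFiniteMeasure (volume.restrict (cube a)) := ⟨by simpa using volume_cube_lt_top a⟩
  have hc := continuous_fourier hφ
  induction n generalizing x with
  | zero =>
    simp only [inversionKernel, pow_zero, one_mul]
    exact setIntegral_cube_exp a x
  | succ n ih =>
    have hterm : ∀ ξ, inversionKernel φ (n + 1) x ξ =
        ∑' y, φ y * inversionKernel φ n (x - y) ξ := fun ξ => by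
      have e : ∀ y, φ y * inversionKernel φ n (x - y) ξ =
          (fourier φ ξ ^ n * Complex.exp (-(Complex.I * ((inner ℝ (latticePt x) ξ : ℝ) : ℂ)))) *
            (φ y * Complex.exp (Complex.I * ((inner ℝ (latticePt y) ξ : ℝ) : ℂ))) := fun y => by
        have hsub : latticePt (x - y) = latticePt x - latticePt y := by
          ext i; simp [latticePt]
        have : Complex.exp (-(Complex.I * ((inner ℝ (latticePt (x - y)) ξ : ℝ) : ℂ))) =
            Complex.exp (-(Complex.I * ((inner ℝ (latticePt x) ξ : ℝ) : ℂ))) *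
              Complex.exp (Complex.I * ((inner ℝ (latticePt y) ξ : ℝ) : ℂ)) := by
          rw [← Complex.exp_add, hsub, inner_sub_left]
          congr 1
          push_cast
          ring
        rw [inversionKernel, this]
        ring
      simp only [e]
      rw [tsum_mul_left, inversionKernel, pow_succ]
      change fourier φ ξ ^ n * fourier φ ξ * _ = _ * fourier φ ξ
      ring
    have hk1 : ∀ y ξ, ‖φ y * inversionKernel φ n (x - y) ξ‖ ≤ ‖φ y‖ := fun y ξ => by
      rw [norm_mul, norm_inversionKernel]
      exact mul_le_of_le_one_right (norm_nonneg _) (pow_le_one₀ (norm_nonneg _) (hle ξ))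
    have hcont : ∀ y, Continuous fun ξ => φ y * inversionKernel φ n (x - y) ξ := fun y =>
      (continuous_inversionKernel hc n (x - y)).const_mul _
    have hint : ∀ y, Integrable (fun ξ => φ y * inversionKernel φ n (x - y) ξ)
        (volume.restrict (cube a)) := fun y =>
      (integrable_const ‖φ y‖).mono' (hcont y).aestronglyMeasurable (Eventually.of_forall (hk1 y))
    have hsum : Summable fun y => ∫ ξ in cube a, ‖φ y * inversionKernel φ n (x - y) ξ‖ := by
      refine (hφ.mul_right (volume.real (cube a))).of_nonneg_of_le
        (fun y => integral_nonneg fun ξ => norm_nonneg _) fun y => ?_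
      refine (integral_mono (hint y).norm (integrable_const ‖φ y‖) (hk1 y)).trans (le_of_eq ?_)
      simp [mul_comm, measureReal_def]
    have h := hasSum_integral_of_summable_integral_norm hint hsum
    simp only [hterm]
    rw [← h.tsum_eq]
    simp only [integral_const_mul, ih]
    change _ = _ * ∑' y, convPow φ n (x - y) * φ y
    rw [← tsum_mul_left]
    congr 1
    ext y
    ring

end Inversion

/-! ### From local decay to the whole cube. -/

section Global

variable {d : ℕ} {φ : (Fin d → ℤ) → ℂ} {μ : ℝ} {x : Fin d → ℤ}

theorem HasLocalDecay.add_latticePt {ξ : E d} (h : HasLocalDecay φ x ξ μ) (m : Fin d → ℤ) :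
    HasLocalDecay φ x (ξ + (2 * Real.pi) • latticePt m) μ := by
  set v : E d := (2 * Real.pi) • latticePt m with hv
  intro W hW
  have hcont : Continuous fun η : E d => η + v := continuous_id.add continuous_const
  have hcont' : Continuous fun η : E d => η - v := continuous_id.sub continuous_const
  obtain ⟨N, hNW, hN, hξN, C, hC⟩ := h ((fun η => η + v) ⁻¹' W) (hcont.tendsto ξ hW)
  refine ⟨(fun η => η - v) ⁻¹' N, fun η hη => ?_, hN.preimage hcont', ?_, C, fun n hn => ?_⟩
  · have := hNW hη
    simpa using this
  · simpa using hξN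
  refine le_of_eq_of_le (congrArg norm ?_) (hC n hn)
  rw [← integral_indicator (hN.preimage hcont').measurableSet,
    ← integral_indicator hN.measurableSet, ← integral_add_right_eq_self _ v]
  congr 1
  ext η
  by_cases hη : η ∈ N
  · rw [indicator_of_mem hη, indicator_of_mem (by simpa using hη), hv,
      inversionKernel_add_latticePt]
  · rw [indicator_of_notMem hη, indicator_of_notMem (by simpa using hη)]

theorem HasLocalDecay.mono {ξ : E d} {ν : ℝ} (h : HasLocalDecay φ x ξ μ) (hν : ν ≤ μ) :
    HasLocalDecay φ x ξ ν := by
  intro W hW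
  obtain ⟨N, hNW, hN, hξN, C, hC⟩ := h W hW
  refine ⟨N, hNW, hN, hξN, |C|, fun n hn => (hC n hn).trans ?_⟩
  have h1 : (1 : ℝ) ≤ n := by exact_mod_cast hn
  calc C * (n : ℝ) ^ (-μ) ≤ |C| * (n : ℝ) ^ (-μ) := by gcongr; exact le_abs_self C
    _ ≤ |C| * (n : ℝ) ^ (-ν) := by gcongr

theorem exists_pow_le_mul_rpow {ρ : ℝ} (hρ0 : 0 ≤ ρ) (hρ : ρ < 1) (μ : ℝ) :
    ∃ C : ℝ, ∀ n : ℕ, 1 ≤ n → ρ ^ n ≤ C * (n : ℝ) ^ (-μ) := by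
  obtain ⟨N, hN⟩ := exists_nat_ge μ
  obtain ⟨C, hC⟩ := (tendsto_pow_const_mul_const_pow_of_abs_lt_one N
    (by rwa [abs_of_nonneg hρ0])).bddAbove_range
  refine ⟨C, fun n hn => ?_⟩
  have h1 : (1 : ℝ) ≤ n := by exact_mod_cast hn
  have hn0 : (0 : ℝ) < n := by linarith
  have h := hC (mem_range_self n)
  rw [Real.rpow_neg hn0.le, ← div_eq_mul_inv, le_div_iff₀ (by positivity), mul_comm]
  refine le_trans ?_ h
  have : (n : ℝ) ^ μ ≤ (n : ℝ) ^ N := by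
    rw [← Real.rpow_natCast]
    exact Real.rpow_le_rpow_of_exponent_le h1 hN
  gcongr

/-- Since no maximum of |φ̂| lies on a face, disjoint decay neighbourhoods fit inside the cube. What
remains of the closed cube is compact and free of maxima, so |φ̂| ≤ ρ < 1 there. -/
theorem norm_setIntegral_cube_le (hc : Continuous (fourier φ)) (hle : ∀ ξ, ‖fourier φ ξ‖ ≤ 1)
    (a : Fin d → ℝ) (hfin : {ξ : E d | ξ ∈ cube a ∧ ‖fourier φ ξ‖ = 1}.Finite)
    (ha : ∀ ξ : E d, ‖fourier φ ξ‖ = 1 → ∀ i, ξ i ≠ a i - Real.pi ∧ ξ i ≠ a i + Real.pi)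
    (hdec : ∀ ξ : E d, ‖fourier φ ξ‖ = 1 → HasLocalDecay φ x ξ μ) :
    ∃ C : ℝ, ∀ n : ℕ, 1 ≤ n →
      ‖∫ ξ in cube a, inversionKernel φ n x ξ‖ ≤ C * (n : ℝ) ^ (-μ) := by
  set Z := {ξ : E d | ξ ∈ cube a ∧ ‖fourier φ ξ‖ = 1} with hZ
  obtain ⟨O, hO, hOd⟩ := hfin.t2_separation
  have hint : ∀ ξ ∈ Z, ∃ V ∈ 𝓝 ξ, V ⊆ cube a := fun ξ hξ => by
    refine ⟨{η | ∀ i, η i ∈ Ioo (a i - Real.pi) (a i + Real.pi)}, ?_,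
      fun η hη i => Ioo_subset_Ioc_self (hη i)⟩
    have hopen : IsOpen {η : E d | ∀ i, η i ∈ Ioo (a i - Real.pi) (a i + Real.pi)} := by
      simp only [ofPred_forall]
      exact isOpen_iInter_of_finite fun i => isOpen_Ioo.preimage (by fun_prop)
    refine hopen.mem_nhds fun i => ⟨?_, ?_⟩
    · exact (hξ.1 i).1
    · exact lt_of_le_of_ne (hξ.1 i).2 (ha ξ hξ.2 i).2
  have hN : ∀ ξ : Z, ∃ N ⊆ O ξ ∩ cube a, IsOpen N ∧ (ξ : E d) ∈ N ∧ ∃ C : ℝ, ∀ n : ℕ, 1 ≤ n →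
      ‖∫ ξ in N, inversionKernel φ n x ξ‖ ≤ C * (n : ℝ) ^ (-μ) := fun ξ => by
    obtain ⟨V, hV, hVc⟩ := hint ξ ξ.2
    obtain ⟨N, hNs, h⟩ := hdec ξ ξ.2.2 (O ξ ∩ V) (inter_mem ((hO ξ).2.mem_nhds (hO ξ).1) hV)
    exact ⟨N, hNs.trans (inter_subset_inter_right _ hVc), h⟩
  choose N hNs hNo hNm C hC using hN
  have : Fintype Z := hfin.fintype
  set T := ⋃ ξ : Z, N ξ with hT
  have hTo : IsOpen T := isOpen_iUnion hNo
  have hTc : T ⊆ cube a := iUnion_subset fun ξ => (hNs ξ).trans inter_subset_right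
  have hdisj : Pairwise (Function.onFun Disjoint N) := fun ξ η hne =>
    (hOd ξ.2 η.2 (Subtype.coe_injective.ne hne)).mono ((hNs ξ).trans inter_subset_left)
      ((hNs η).trans inter_subset_left)
  have hK : IsCompact ({ξ : E d | ∀ i, ξ i ∈ Icc (a i - Real.pi) (a i + Real.pi)} \ T) :=
    (isCompact_closedCube a).diff hTo
  obtain ⟨ρ, hρ0, hρ1, hρ⟩ : ∃ ρ : ℝ, 0 ≤ ρ ∧ ρ < 1 ∧ ∀ ξ ∈ cube a \ T, ‖fourier φ ξ‖ ≤ ρ := by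
    have hlt : ∀ ξ ∈ {ξ : E d | ∀ i, ξ i ∈ Icc (a i - Real.pi) (a i + Real.pi)} \ T,
        0 < 1 - ‖fourier φ ξ‖ := fun ξ hξ => by
      refine sub_pos.2 (lt_of_le_of_ne (hle ξ) fun h1 => hξ.2 ?_)
      have hm : ξ ∈ Z := ⟨fun i => ⟨lt_of_le_of_ne (hξ.1 i).1 (ha ξ h1 i).1.symm, (hξ.1 i).2⟩, h1⟩
      exact mem_iUnion.2 ⟨⟨ξ, hm⟩, hNm ⟨ξ, hm⟩⟩
    obtain ⟨c, hc0, hcK⟩ := hK.exists_forall_le' (by fun_prop) hlt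
    refine ⟨max 0 (1 - c), le_max_left _ _, max_lt one_pos (by linarith), fun ξ hξ => ?_⟩
    refine le_max_of_le_right ?_
    linarith [hcK ξ ⟨fun i => Ioc_subset_Icc_self (hξ.1 i), hξ.2⟩]
  obtain ⟨C', hC'⟩ := exists_pow_le_mul_rpow hρ0 hρ1 μ
  refine ⟨∑ ξ, C ξ + C' * volume.real (cube a \ T), fun n hn => ?_⟩
  have : IsFiniteMeasure (volume.restrict (cube a)) := ⟨by simpa using volume_cube_lt_top a⟩
  have hintg : IntegrableOn (inversionKernel φ n x) (cube a) :=
    (integrable_const (1 : ℝ)).mono' (continuous_inversionKernel hc n x).aestronglyMeasurable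
      (Eventually.of_forall fun ξ => by
        rw [norm_inversionKernel]
        exact pow_le_one₀ (norm_nonneg _) (hle ξ))
  have hsplit : ∫ ξ in cube a, inversionKernel φ n x ξ =
      (∑ ξ, ∫ η in N ξ, inversionKernel φ n x η) + ∫ ξ in cube a \ T, inversionKernel φ n x ξ := by
    rw [← integral_iUnion_fintype (fun ξ => (hNo ξ).measurableSet) hdisj fun ξ =>
      hintg.mono_set ((hNs ξ).trans inter_subset_right), setIntegral_sdiff hTo.measurableSet hintg hTc]
    ring
  rw [hsplit, add_mul, Finset.sum_mul]
  refine (norm_add_le _ _).trans (add_le_add ?_ ?_)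
  · exact (norm_sum_le _ _).trans (Finset.sum_le_sum fun ξ _ => hC ξ n hn)
  · refine (norm_setIntegral_le_of_norm_le_const
      ((measure_mono sdiff_subset).trans_lt (volume_cube_lt_top a)) fun ξ hξ => ?_).trans
      (le_of_eq ?_) (b := C' * (n : ℝ) ^ (-μ) * volume.real (cube a \ T))
    · rw [norm_inversionKernel]
      exact (pow_le_pow_left₀ (norm_nonneg _) (hρ ξ hξ) n).trans (hC' n hn)
    · ring

theorem maxSet_eq (φ : (Fin d → ℤ) → ℂ) :
    maxSet φ = {ξ : E d | ξ ∈ cube 0 ∧ ‖fourier φ ξ‖ = 1} := by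
  ext ξ
  simp [maxSet, cube]

theorem exists_add_latticePt_mem_maxSet {ξ : E d} (hξ : ‖fourier φ ξ‖ = 1) :
    ∃ m : Fin d → ℤ, ∃ ξ₀ ∈ maxSet φ, ξ = ξ₀ + (2 * Real.pi) • latticePt m := by
  obtain ⟨m, hm⟩ := exists_sub_latticePt_mem_cube 0 ξ
  refine ⟨-m, ξ + (2 * Real.pi) • latticePt m, ?_, ?_⟩
  · rw [maxSet_eq]
    exact ⟨hm, by rw [fourier_add_latticePt, hξ]⟩
  · have : latticePt (-m) = -latticePt m := by ext i; simp [latticePt]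
    rw [this, smul_neg, add_neg_cancel_right]

/-- An infinite set of maxima would accumulate in the closed cube at a point that is again a
maximum, by continuity. That point may lie outside the half-open cube, so isolation is assumed at
all maxima. -/
theorem finite_of_isolated (hc : Continuous (fourier φ))
    (hiso : ∀ ξ : E d, ‖fourier φ ξ‖ = 1 → ∀ᶠ η in 𝓝 ξ, η ≠ ξ → ‖fourier φ η‖ < 1)
    (a : Fin d → ℝ) : {ξ : E d | ξ ∈ cube a ∧ ‖fourier φ ξ‖ = 1}.Finite := by
  by_contra hinf
  have hsub : {ξ : E d | ξ ∈ cube a ∧ ‖fourier φ ξ‖ = 1} ⊆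
      {ξ : E d | ∀ i, ξ i ∈ Icc (a i - Real.pi) (a i + Real.pi)} :=
    fun ξ hξ i => Ioc_subset_Icc_self (hξ.1 i)
  obtain ⟨ξ, -, hacc⟩ :=
    Set.Infinite.exists_accPt_of_subset_isCompact hinf (isCompact_closedCube a) hsub
  rw [accPt_iff_frequently] at hacc
  have hcl : IsClosed {ξ : E d | ‖fourier φ ξ‖ = 1} := isClosed_eq hc.norm continuous_const
  have h1 : ‖fourier φ ξ‖ = 1 :=
    hcl.closure_subset (mem_closure_iff_frequently.2 (hacc.mono fun η hη => hη.2.2))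
  obtain ⟨η, h2, h3⟩ := (hacc.and_eventually (hiso ξ h1)).exists
  exact absurd h2.2.2 (h3 h2.1).ne

theorem maxSet_nonempty (hc : Continuous (fourier φ))
    (hsup : IsLUB (range fun ξ : E d => ‖fourier φ ξ‖) 1) : (maxSet φ).Nonempty := by
  obtain ⟨ξ, -, hξ⟩ := (isCompact_closedCube (0 : Fin d → ℝ)).exists_isMaxOn
    ⟨0, fun i => by simp [Real.pi_pos.le]⟩ hc.norm.continuousOn
  have hub : ∀ η, ‖fourier φ η‖ ≤ ‖fourier φ ξ‖ := fun η => by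
    obtain ⟨m, hm⟩ := exists_sub_latticePt_mem_cube 0 η
    rw [← fourier_add_latticePt φ m η]
    exact hξ fun i => Ioc_subset_Icc_self (hm i)
  have h1 : ‖fourier φ ξ‖ = 1 :=
    le_antisymm (hsup.1 (mem_range_self ξ)) (hsup.2 (by rintro _ ⟨η, rfl⟩; exact hub η))
  obtain ⟨-, ξ₀, hξ₀, -⟩ := exists_add_latticePt_mem_maxSet h1
  exact ⟨ξ₀, hξ₀⟩

/-- Points of `maxSet φ` may lie on a face of (-π, π]^d, so the cube is moved. The i-th coordinates
of all maxima form a countable set, and a centre coordinate avoiding its shifts by ±π exists. -/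
theorem exists_cube_center (hfin : (maxSet φ).Finite) : ∃ a : Fin d → ℝ,
    ∀ ξ : E d, ‖fourier φ ξ‖ = 1 → ∀ i, ξ i ≠ a i - Real.pi ∧ ξ i ≠ a i + Real.pi := by
  have h : ∀ i : Fin d, ∃ c : ℝ, ∀ ξ : E d, ‖fourier φ ξ‖ = 1 →
      ξ i ≠ c - Real.pi ∧ ξ i ≠ c + Real.pi := fun i => by
    set S : Set ℝ := (fun p : E d × ℤ => p.1 i + 2 * Real.pi * p.2) '' (maxSet φ ×ˢ univ) with hS
    have hScount : S.Countable := (hfin.countable.prod countable_univ).image _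
    have hmem : ∀ ξ : E d, ‖fourier φ ξ‖ = 1 → ξ i ∈ S := fun ξ hξ => by
      obtain ⟨m, ξ₀, hξ₀, rfl⟩ := exists_add_latticePt_mem_maxSet hξ
      exact ⟨(ξ₀, m i), ⟨hξ₀, mem_univ _⟩, by simp [latticePt]⟩
    obtain ⟨c, hc⟩ := (((hScount.image (fun s => s + Real.pi)).union
      (hScount.image (fun s => s - Real.pi))).dense_compl ℝ).nonempty
    refine ⟨c, fun ξ hξ => ⟨fun h => hc (Or.inl ⟨ξ i, hmem ξ hξ, ?_⟩),
      fun h => hc (Or.inr ⟨ξ i, hmem ξ hξ, ?_⟩)⟩⟩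
    · simp only [h]; ring
    · simp only [h]; ring
  choose a ha using h
  exact ⟨a, fun ξ hξ i => ha i ξ hξ⟩

theorem finite_latticePt_mem {K : Set (E d)} (hK : IsCompact K) :
    {x : Fin d → ℤ | latticePt x ∈ K}.Finite := by
  obtain ⟨M, hM⟩ := hK.isBounded.exists_norm_le
  refine (finite_Icc (fun _ : Fin d => -⌈M⌉) (fun _ => ⌈M⌉)).subset fun x hx => ?_
  have h : ∀ i, |(x i : ℝ)| ≤ ⌈M⌉ := fun i =>
    ((PiLp.norm_apply_le (latticePt x) i).trans (hM _ hx)).trans (Int.le_ceil M)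
  refine ⟨fun i => ?_, fun i => ?_⟩
  · have := (abs_le.1 (h i)).1
    exact_mod_cast this
  · have := (abs_le.1 (h i)).2
    exact_mod_cast this

/-- The chosen order is realised by some expansion of one of the two types. This is all the proof
uses; independence of the choice is not needed. -/
theorem hasType_homogeneousOrder {ξ₀ : E d}
    (h : IsPositiveHomogeneousType φ ξ₀ ∨ IsImaginaryHomogeneousType φ ξ₀) :
    HasPositiveHomogeneousType φ ξ₀ (homogeneousOrder φ ξ₀) ∨
      HasImaginaryHomogeneousType φ ξ₀ (homogeneousOrder φ ξ₀) := by
  have h' : ∃ μ, HasPositiveHomogeneousType φ ξ₀ μ ∨ HasImaginaryHomogeneousType φ ξ₀ μ := by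
    rcases h with ⟨μ, h⟩ | ⟨μ, h⟩
    exacts [⟨μ, Or.inl h⟩, ⟨μ, Or.inr h⟩]
  rw [homogeneousOrder, dif_pos h']
  exact h'.choose_spec

end Global

end ConvPower

/-! ### The theorem. -/

open ConvPower Filter in
theorem theorem3p2 (d : ℕ) (hd : 1 ≤ d) (φ : (Fin d → ℤ) → ℂ) (hφ : ConvPower.MemS φ)
    (hsup : IsLUB (Set.range fun ξ : ConvPower.E d => ‖ConvPower.fourier φ ξ‖) 1)
    (htype : ∀ ξ₀ ∈ ConvPower.maxSet φ,
      ConvPower.IsPositiveHomogeneousType φ ξ₀ ∨ ConvPower.IsImaginaryHomogeneousType φ ξ₀)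
    (himag : ∀ ξ₀ ∈ ConvPower.maxSet φ, ConvPower.IsImaginaryHomogeneousType φ ξ₀ →
      ConvPower.drift φ ξ₀ = 0 ∧ ConvPower.homogeneousOrder φ ξ₀ < 1) :
    (ConvPower.maxSet φ).Finite ∧
    IsLeast (ConvPower.homogeneousOrder φ '' ConvPower.maxSet φ) (ConvPower.minOrder φ) ∧
    ∀ K : Set (ConvPower.E d), IsCompact K →
      ∃ C : ℝ, 0 < C ∧ ∀ x : Fin d → ℤ, ConvPower.latticePt x ∈ K → ∀ n : ℕ, 1 ≤ n →
        ‖ConvPower.convPow φ n x‖ ≤ C / (n : ℝ) ^ ConvPower.minOrder φ := by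
  have hsum := hφ.summable_norm
  have hc := continuous_fourier hsum
  have hle : ∀ ξ, ‖fourier φ ξ‖ ≤ 1 := fun ξ => hsup.1 (Set.mem_range_self ξ)
  have hiso₀ : ∀ ξ₀ ∈ maxSet φ, ∀ᶠ η in 𝓝 ξ₀, η ≠ ξ₀ → ‖fourier φ η‖ < 1 := fun ξ₀ hξ₀ => by
    rcases htype ξ₀ hξ₀ with ⟨μ, h⟩ | ⟨μ, h⟩
    exacts [h.eventually_norm_fourier_lt_one hξ₀.2, h.eventually_norm_fourier_lt_one hξ₀.2]
  have hiso : ∀ ξ : E d, ‖fourier φ ξ‖ = 1 → ∀ᶠ η in 𝓝 ξ, η ≠ ξ → ‖fourier φ η‖ < 1 := by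
    intro ξ hξ
    obtain ⟨m, ξ₀, hξ₀, rfl⟩ := exists_add_latticePt_mem_maxSet hξ
    have hcont : Continuous fun η : E d => η - (2 * Real.pi) • latticePt m :=
      continuous_id.sub continuous_const
    have ht := hcont.tendsto' (ξ₀ + (2 * Real.pi) • latticePt m) ξ₀ (add_sub_cancel_right _ _)
    filter_upwards [ht.eventually (hiso₀ ξ₀ hξ₀)] with η hη hne
    have := hη fun h => hne (sub_eq_iff_eq_add.1 h)
    rwa [← fourier_add_latticePt φ m, sub_add_cancel] at this
  have hfin : (maxSet φ).Finite := by
    rw [maxSet_eq]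
    exact finite_of_isolated hc hiso 0
  have hmin : IsLeast (homogeneousOrder φ '' maxSet φ) (minOrder φ) :=
    ⟨((maxSet_nonempty hc hsup).image _).csInf_mem (hfin.image _),
      fun _ h => csInf_le (hfin.image _).bddBelow h⟩
  refine ⟨hfin, hmin, fun K hK => ?_⟩
  obtain ⟨a, ha⟩ := exists_cube_center hfin
  have hdec : ∀ (x : Fin d → ℤ) (ξ : E d), ‖fourier φ ξ‖ = 1 →
      HasLocalDecay φ x ξ (minOrder φ) := fun x ξ hξ => by
    obtain ⟨m, ξ₀, hξ₀, rfl⟩ := exists_add_latticePt_mem_maxSet hξ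
    refine HasLocalDecay.add_latticePt ?_ m
    refine HasLocalDecay.mono (μ := homogeneousOrder φ ξ₀) ?_ (hmin.2 (Set.mem_image_of_mem _ hξ₀))
    rcases hasType_homogeneousOrder (htype ξ₀ hξ₀) with h | h
    · exact h.hasLocalDecay hξ₀.2 x
    · obtain ⟨h1, h2⟩ := himag ξ₀ hξ₀ ⟨_, h⟩
      exact h.hasLocalDecay hξ₀.2 hc hle h1 h2 x
  choose C hC using fun x => norm_setIntegral_cube_le hc hle a (finite_of_isolated hc hiso a) ha
    (hdec x)
  have hKfin := finite_latticePt_mem hK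
  -- Summing over the finitely many lattice points of K dominates each constant `C x`; the 1 ensures
  -- positivity. The inversion factor (2π)^d ≥ 1 is simply dropped.
  refine ⟨1 + ∑ x ∈ hKfin.toFinset, |C x|, by positivity, fun x hx n hn => ?_⟩
  have h := hC x n hn
  have hn0 : (0 : ℝ) < n := by exact_mod_cast hn
  have hpi : (1 : ℝ) ≤ (2 * Real.pi) ^ d := one_le_pow₀ (by linarith [Real.pi_gt_three])
  rw [setIntegral_cube_inversionKernel hsum hle, norm_mul, norm_pow, norm_mul, Complex.norm_real,
    Complex.norm_ofNat, Real.norm_of_nonneg Real.pi_pos.le] at h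
  rw [div_eq_mul_inv, ← Real.rpow_neg hn0.le]
  calc ‖convPow φ n x‖ ≤ (2 * Real.pi) ^ d * ‖convPow φ n x‖ :=
        le_mul_of_one_le_left (norm_nonneg _) hpi
    _ ≤ C x * (n : ℝ) ^ (-minOrder φ) := h
    _ ≤ _ := by
        gcongr
        have : |C x| ≤ ∑ x ∈ hKfin.toFinset, |C x| :=
          Finset.single_le_sum (f := fun x => |C x|) (fun _ _ => abs_nonneg _)
            (hKfin.mem_toFinset.2 hx)
        linarith [le_abs_self (C x)]
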